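/- For $\tau,L>0$ let $\mathcal F_{\tau,L}$ be the class of differentiable $f:\mathbb R^n\to\mathbb R$ that attain their minimum and satisfy $f(y)\ge f(x)+\langle\nabla f(x),y-x\rangle+\frac{\tau}{2}\|x-y\|^2$ and $\|\nabla f(x)-\nabla f(y)\|\le L\|x-y\|$ for all $x,y$; let $x_f^*$ be the minimizer of $f$. A comparison oracle for $f$ with parameters $\kappa\ge1$, $\mu>0$, $0<\delta_0\le\frac12$ answers every query $(x,y)$ by a fresh, independent draw of a $\{-1,1\}$-valued random variable $C_f(x,y)$ such that, whenever $f(x)\ne f(y)$, $$\mathbb P\big(C_f(x,y)=\operatorname{sign}\{f(y)-f(x)\}\big)\ \ge\ \tfrac12+\min\{\delta_0,\ \mu|f(y)-f(x)|^{\kappa-1}\}.$$ A coordinate-descent algorithm starts at a given $x_0\in\mathbb R^n$. In iteration $k$ it draws $i$ uniformly from $\{1,\dots,n\}$, finds a step size $\alpha_k$ by a robust line search along $\alpha\mapsto x_k+\alpha e_i$, and sets $x_{k+1}=x_k+\alpha_ke_i$. A robust line search proceeds in rounds, of which there is at least one. In a round, two comparisons, of one base step size with two probe step sizes, are each repeated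 (in turn) until one of the two repeated-query subroutines stops; with its confidence parameter $\delta'\in(0,1)$, a subroutine stops at the first $l\ge0$ at which half the absolute value of the mean of its first $2^{l+1}-1$ answers is at least $\sqrt{(l+1)\log(2/\delta')/2^l}$, and it returns the sign of their sum. The next round, or the final $\alpha_k$, is a function of $k$ and of which subroutine stopped and the sign it returned, in all earlier rounds of this line search. The estimate $\widehat x_T$ is the current iterate when $T$ queries have been made. **Theorem.** There is a family of such algorithms, which may depend on $n,\tau,L,T,\delta$ but not on $\kappa,\mu,\delta_0$ (nor on $f$, $x_0$, or $M$ below), such that the following holds. For every $\kappa\ge1$ there is $a\in\mathbb N$, and for all $\mu,\delta_0,\tau,L$ as above and all $M\in\mathbb R$ there are constants $C_1,C_2,C_3>0$, such that for all $n\ge1$, $T\ge1$, $\delta\in(0,1)$, every $f\in\mathcal F_{\tau,L}$, every comparison oracle for $f$ with parameters $(\kappa,\mu,\delta_0)$, and every $x_0$ with $f(x_0)-f(x_f^*)\le M$, there is an event $A$ of probability at least $1-\delta$ (over the answers of the oracle and the random coordinates) with $$\mathbb E\big[f(\widehat x_T)-f(x_f^*)\,\big|\,A\big]\ \le\ \begin{cases}c_1\exp\{-c_2\sqrt{T/n}\}&\text{if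 }\kappa=1,\\[2pt] c_3\,n\,(n/T)^{\frac1{2(\kappa-1)}}&\text{if }\kappa>1,\end{cases}$$ where $c_1=C_1\Lambda^{a}$, $c_2=C_2\Lambda^{-a}$, $c_3=C_3\Lambda^{a}$ and $\Lambda=(1+\log T)(1+\log n)(1+\log(1/\delta))$. -/

import Mathlib

open scoped ENNReal

namespace PairwiseDescent

/-- `ℝⁿ` with the Euclidean norm. -/
abbrev E (n : ℕ) : Type := EuclideanSpace ℝ (Fin n)

/-- The class of `τ`-strongly convex functions on `ℝⁿ` with `L`-Lipschitz gradient
that attain their minimum. -/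
structure StronglyConvexSmooth {n : ℕ} (τ L : ℝ) (f : E n → ℝ) : Prop where
  differentiable : Differentiable ℝ f
  strongly_convex : ∀ x y : E n,
    f x + inner ℝ (gradient f x) (y - x) + τ / 2 * ‖x - y‖ ^ 2 ≤ f y
  lipschitz_gradient : ∀ x y : E n, ‖gradient f x - gradient f y‖ ≤ L * ‖x - y‖
  attains_min : ∃ x : E n, ∀ y : E n, f x ≤ f y

/-- A (noisy) comparison oracle: `C x y` is the law of the binary answer to the query `(x, y)`.
The answer `true` stands for `+1`, that is for the claim `f x < f y`; `false` stands for `-1`. -/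
abbrev Oracle (n : ℕ) : Type := E n → E n → PMF Bool

/-- `C` is a comparison oracle for `f` with parameters `(κ, μ, δ₀)`: the answer to `(x, y)` equals
the sign of `f y - f x` with probability at least `1/2 + min {δ₀, μ |f y - f x| ^ (κ - 1)}`.
Nothing is required when `f x = f y`, since then neither of the two answers is the sign. -/
def IsComparisonOracle {n : ℕ} (κ μ δ₀ : ℝ) (f : E n → ℝ) (C : Oracle n) : Prop :=
  ∀ x y : E n, f x ≠ f y →
    1 / 2 + min δ₀ (μ * |f y - f x| ^ (κ - 1)) ≤ (C x y (decide (f x < f y))).toReal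

/-! ### The repeated querying subroutine -/

/-- The draws of one comparison made so far: their number, and the sum of the answers `±1`. -/
structure Tally where
  draws : ℕ
  sum : ℤ

/-- No draws yet. -/
def Tally.empty : Tally := ⟨0, 0⟩

/-- Record one more answer. -/
def Tally.add (t : Tally) (answer : Bool) : Tally :=
  ⟨t.draws + 1, t.sum + if answer then 1 else -1⟩

/-- The stopping rule of the repeated querying subroutine with confidence parameter `δ`.
Draws come in batches of sizes `2 ^ 0, 2 ^ 1, …`. After batch `l` there are `2 ^ (l + 1) - 1` draws,
and the subroutine stops when half the empirical mean of the answers is, in absolute value, at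
least `Δ_l = √((l + 1) log (2 / δ) / 2 ^ l)`. It then returns the sign of the sum. -/
def Tally.Stops (δ : ℝ) (t : Tally) : Prop :=
  ∃ l : ℕ, t.draws + 1 = 2 ^ (l + 1) ∧
    √((l + 1) * Real.log (2 / δ) / 2 ^ l) ≤ |(1 / 2 : ℝ) * (t.sum / t.draws)|

/-! ### Robust line searches -/

/-- One round of a robust line search along the line `α ↦ x + α d`. The step size `base` is compared
with the two step sizes `probe₁` and `probe₂`, by two repeated querying subroutines with confidence
parameter `conf` that run in parallel until the first of them stops. -/
structure Round where
  base : ℝ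
  probe₁ : ℝ
  probe₂ : ℝ
  conf : ℝ
  conf_pos : 0 < conf
  conf_lt_one : conf < 1

/-- The outcome of a round: which of the two subroutines stopped (`second = true` if it is the one
for `probe₂`), and the sign it returned (`larger = true` if it says that the objective is larger
at the probe than at the base). -/
structure Decision where
  second : Bool
  larger : Bool

/-- A line search: a first round and, after every round, as a function of the outcomes of all the
rounds of this line search so far (in chronological order), either the next round
or the final step size. -/
structure LineSearch where
  start : Round
  next : List Decision → Round ⊕ ℝ

/-- A coordinate-descent algorithm: iteration `k` uses the line search `A k`
along a uniformly random coordinate. -/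
abbrev CoordinateDescent : Type := ℕ → LineSearch

/-! ### Running the algorithm -/

/-- The state of a run after some number of oracle queries. -/
structure State (n : ℕ) where
  /-- the current iterate -/
  point : E n
  /-- the number of completed iterations -/
  iter : ℕ
  /-- the coordinate of the current line search -/
  coord : Fin n
  /-- the outcomes of the completed rounds of the current line search -/
  history : List Decision
  /-- the current round -/
  round : Round
  /-- the draws in the current round that compare the base with `probe₁` -/
  tally₁ : Tally
  /-- the draws in the current round that compare the base with `probe₂` -/
  tally₂ : Tally

/-- Begin iteration `k` at the iterate `x`: choose a coordinate uniformly at random. -/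
noncomputable def beginIteration {n : ℕ} [NeZero n] (A : CoordinateDescent) (k : ℕ) (x : E n) :
    PMF (State n) :=
  (PMF.uniformOfFintype (Fin n)).map fun i =>
    { point := x, iter := k, coord := i, history := [], round := (A k).start,
      tally₁ := Tally.empty, tally₂ := Tally.empty }

/-- Continue after a completed round: start the next round of the line search, or take the step
`x + α eᵢ` that the line search has found and begin the next iteration. -/
noncomputable def afterRound {n : ℕ} [NeZero n] (A : CoordinateDescent) (s : State n)
    (d : Decision) : PMF (State n) :=
  match (A s.iter).next (s.history ++ [d]) with
  | Sum.inl r => PMF.pure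
      { s with history := s.history ++ [d], round := r,
               tally₁ := Tally.empty, tally₂ := Tally.empty }
  | Sum.inr α => beginIteration A (s.iter + 1) (s.point + EuclideanSpace.single s.coord α)

open Classical in
/-- One oracle query with everything that the algorithm does until the next query. The two
subroutines of the current round take turns, the one for `probe₁` first, and every answer is a
fresh draw. -/
noncomputable def step {n : ℕ} [NeZero n] (A : CoordinateDescent) (C : Oracle n) (s : State n) :
    PMF (State n) :=
  let at_ : ℝ → E n := fun α => s.point + EuclideanSpace.single s.coord α
  if s.tally₁.draws ≤ s.tally₂.draws then
    (C (at_ s.round.base) (at_ s.round.probe₁)).bind fun answer =>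
      let t := s.tally₁.add answer
      if t.Stops s.round.conf then afterRound A s ⟨false, decide (0 < t.sum)⟩
      else PMF.pure { s with tally₁ := t }
  else
    (C (at_ s.round.base) (at_ s.round.probe₂)).bind fun answer =>
      let t := s.tally₂.add answer
      if t.Stops s.round.conf then afterRound A s ⟨true, decide (0 < t.sum)⟩
      else PMF.pure { s with tally₂ := t }

/-- A complete record of a run: its present state, and all earlier states (latest first). -/
abbrev Run (n : ℕ) : Type := State n × List (State n)

/-- The law of the run of the algorithm `A` with the oracle `C` and the starting point `x₀`
when exactly `T` oracle queries have been made. -/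
noncomputable def runLaw {n : ℕ} [NeZero n] (A : CoordinateDescent) (C : Oracle n) (x₀ : E n) :
    ℕ → PMF (Run n)
  | 0 => (beginIteration A 0 x₀).map fun s => (s, [])
  | T + 1 => (runLaw A C x₀ T).bind fun r => (step A C r.1).map fun s => (s, r.1 :: r.2)

/-- The estimate of the minimizer that a run outputs: its present iterate. -/
def Run.estimate {n : ℕ} (r : Run n) : E n := r.1.point

/-- The conditional expectation `𝔼[g | A]` of `g ≥ 0` given an event `A` of positive probability. -/
noncomputable def condMean {Ω : Type*} (P : PMF Ω) (A : Set Ω) (g : Ω → ℝ≥0∞) : ℝ≥0∞ :=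
  (∑' ω, A.indicator (fun ω => P ω * g ω) ω) / P.toOuterMeasure A

/-- The logarithmic factor whose powers bound the polylogarithmic dependence on `T`, `n`, `1/δ`. -/
noncomputable def logFactor (T n : ℕ) (δ : ℝ) : ℝ :=
  (1 + Real.log T) * (1 + Real.log n) * (1 + Real.log (1 / δ))

/-- The error bound: `c₁ exp (-c₂ √(T / n))` for `κ = 1` and `c₃ n (n / T) ^ (1 / (2 (κ - 1)))`
for `κ > 1`. -/
noncomputable def errorBound (κ c₁ c₂ c₃ : ℝ) (n T : ℕ) : ℝ :=
  if κ = 1 then c₁ * Real.exp (-c₂ * √((T : ℝ) / n))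
  else c₃ * n * ((n : ℝ) / T) ^ (1 / (2 * (κ - 1)))

end PairwiseDescent

open PairwiseDescent

namespace PairwiseDescent

/-! Each line search is a noisy bisection. The interval starts as `[-B, B]`; its midpoint is
compared with the two quarter points, and each round discards a quarter of it. By strong convexity
at least one probe exceeds the midpoint by a multiple of the squared width (`exists_gap`), so
running both comparisons in parallel finishes quickly even if the other one is nearly a tie. Any
correct answer, from either comparison, allows a quarter to be discarded without losing the line
minimizer (`IsLineMin.mem_shrink`). The final step never increases `f` (`IsLineMin.finalStep_le`),
and for large `B` it decreases `f` by `g_i ^ 2 / (4 L)` up to the squared final width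
(`IsLineMin.finalStep_decrease`). Averaging over the coordinate `i` gives a contraction by `1 - ρ /
n` per iteration. The number of rounds grows linearly in `k / n`, so that the error of iteration `k`
is of order `exp (-ρ k / (2 n)) / n`, small enough to keep half of that rate.

The probability is handled by two potentials that are supermartingales on a process killed at the
first bad transition (`expect_goodRuns_le`). One adds up Chernoff exponentials for a wrong sign or a
late stop (`Inv.expect_step_failPot`) and shows that killing is unlikely. The other forecasts the
error after `K` iterations (`IsBound.expect_step_valPot`). Together they give
`IsBound.exists_event`.

The number `K` occurs only in the analysis, which is why the algorithm needs neither the noise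
parameters nor `M`. It suffices that the first `K` iterations fit into `T` queries
(`exists_event_of_budget`), where one iteration costs about `(1 + K / n) / advantage ^ 2` up to
logarithms. For `κ = 1` the advantage is constant, so `K` is of order `√(n T)`. For `κ > 1` it
decays like `(decay / n) ^ (κ - 1)`, and the budget stops the decay near `n (n / T) ^ (1 / (2 (κ -
1)))`. -/

/-! ### Expectations of nonnegative functions under a `PMF` -/

/-- The expectation of a nonnegative function. -/
noncomputable def expect {α : Type*} (P : PMF α) (g : α → ℝ≥0∞) : ℝ≥0∞ := ∑' a, P a * g a

section Expect
variable {α β : Type*}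

lemma expect_pure (a : α) (g : α → ℝ≥0∞) : expect (PMF.pure a) g = g a := by
  unfold expect
  rw [tsum_eq_single a]
  · simp
  · intro b hb; simp [PMF.pure_apply, hb]

lemma expect_bind (P : PMF α) (k : α → PMF β) (g : β → ℝ≥0∞) :
    expect (P.bind k) g = expect P fun a => expect (k a) g := by
  unfold expect
  simp only [PMF.bind_apply, ← ENNReal.tsum_mul_right, ← ENNReal.tsum_mul_left]
  rw [ENNReal.tsum_comm]
  simp only [mul_assoc]

lemma expect_map (P : PMF α) (k : α → β) (g : β → ℝ≥0∞) :
    expect (P.map k) g = expect P fun a => g (k a) := by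
  rw [PMF.map, expect_bind]
  simp [expect_pure]

lemma expect_mono (P : PMF α) {g h : α → ℝ≥0∞} (H : ∀ a, g a ≤ h a) : expect P g ≤ expect P h :=
  ENNReal.tsum_le_tsum fun a => by gcongr; exact H a

lemma expect_const (P : PMF α) (c : ℝ≥0∞) : expect P (fun _ => c) = c := by
  unfold expect
  rw [ENNReal.tsum_mul_right, P.tsum_coe, one_mul]

lemma expect_le_of_le (P : PMF α) {g : α → ℝ≥0∞} {c : ℝ≥0∞} (H : ∀ a, g a ≤ c) :
    expect P g ≤ c :=
  (expect_mono P H).trans (expect_const P c).le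

lemma expect_add (P : PMF α) (g h : α → ℝ≥0∞) :
    expect P (fun a => g a + h a) = expect P g + expect P h := by
  unfold expect
  simp only [mul_add]
  exact ENNReal.tsum_add

lemma expect_tsum {ι : Type*} (P : PMF α) (g : ι → α → ℝ≥0∞) :
    expect P (fun a => ∑' i, g i a) = ∑' i, expect P (g i) := by
  unfold expect
  simp only [← ENNReal.tsum_mul_left]
  exact ENNReal.tsum_comm

lemma expect_bool (P : PMF Bool) (g : Bool → ℝ) (hg : ∀ a, 0 ≤ g a) :
    expect P (fun a => ENNReal.ofReal (g a)) =
      ENNReal.ofReal ((P true).toReal * g true + (P false).toReal * g false) := by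
  unfold expect
  rw [ENNReal.ofReal_add (mul_nonneg ENNReal.toReal_nonneg (hg _))
    (mul_nonneg ENNReal.toReal_nonneg (hg _)), ENNReal.ofReal_mul ENNReal.toReal_nonneg,
    ENNReal.ofReal_mul ENNReal.toReal_nonneg, ENNReal.ofReal_toReal (P.apply_ne_top _),
    ENNReal.ofReal_toReal (P.apply_ne_top _), tsum_fintype]
  simp

lemma toReal_true_add_false (P : PMF Bool) : (P true).toReal + (P false).toReal = 1 := by
  rw [← ENNReal.toReal_add (P.apply_ne_top _) (P.apply_ne_top _)]
  have h := P.tsum_coe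
  rw [tsum_fintype, Fintype.sum_bool] at h
  simp [h]

lemma expect_uniform {n : ℕ} [NeZero n] (g : Fin n → ℝ) (hg : ∀ i, 0 ≤ g i) :
    expect (PMF.uniformOfFintype (Fin n)) (fun i => ENNReal.ofReal (g i)) =
      ENNReal.ofReal ((∑ i, g i) / n) := by
  have hn : (0 : ℝ) < n := by exact_mod_cast NeZero.pos n
  unfold expect
  simp only [PMF.uniformOfFintype_apply, Fintype.card_fin]
  rw [tsum_fintype, ← Finset.mul_sum, ← ENNReal.ofReal_sum_of_nonneg fun i _ => hg i,
    div_eq_inv_mul, ENNReal.ofReal_mul (by positivity), ENNReal.ofReal_inv_of_pos hn,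
    ENNReal.ofReal_natCast]

end Expect

/-! ### Exponential moments of one answer -/

/-- The left side decreases in `p`, and at `p = 1 / 2` it is `cosh u`. -/
lemma exp_moment_wrong {p p' u : ℝ} (hp : p + p' = 1) (h : 1 / 2 ≤ p) (hu : 0 ≤ u) :
    p * Real.exp (-u) + p' * Real.exp u ≤ Real.exp (u ^ 2 / 2) := by
  have h1 : Real.exp (-u) ≤ Real.exp u := Real.exp_le_exp.2 (by linarith)
  have h2 := Real.cosh_le_exp_half_sq u
  rw [Real.cosh_eq] at h2
  have : p' = 1 - p := by linarith
  subst this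
  nlinarith

/-- The moment is `cosh e - (2 p - 1) sinh e`. The drift gains at least `2 e ^ 2`, while `cosh e ≤ 1
+ e ^ 2`, which leaves `1 - e ^ 2`. -/
lemma exp_moment_right {p p' e : ℝ} (hp : p + p' = 1) (h : 1 / 2 + e ≤ p) (he : 0 < e)
    (he' : e ≤ 1 / 2) :
    p * Real.exp (-e) + p' * Real.exp e ≤ Real.exp (-e ^ 2) := by
  have h2 := Real.cosh_le_exp_half_sq e
  rw [Real.cosh_eq] at h2
  have h3 : e ≤ Real.sinh e := Real.self_le_sinh_iff.2 he.le
  rw [Real.sinh_eq] at h3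
  have hp' : p' = 1 - p := by linarith
  subst hp'
  have h4 : p * Real.exp (-e) + (1 - p) * Real.exp e ≤ Real.exp (e ^ 2 / 2) - 2 * e * e := by
    nlinarith
  have h5 : Real.exp (e ^ 2 / 2) ≤ 1 + e ^ 2 := by
    have h6 : 1 - e ^ 2 / 2 ≤ Real.exp (-(e ^ 2 / 2)) := by
      have := Real.add_one_le_exp (-(e ^ 2 / 2)); linarith
    have h7 : Real.exp (e ^ 2 / 2) * Real.exp (-(e ^ 2 / 2)) = 1 := by
      rw [← Real.exp_add]; simp
    have h8 : 0 < Real.exp (e ^ 2 / 2) := Real.exp_pos _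
    have h9 : e ^ 2 ≤ 1 / 4 := by nlinarith
    nlinarith [mul_le_mul_of_nonneg_left h6 h8.le, sq_nonneg e, sq_nonneg (e ^ 2)]
  have h10 := Real.add_one_le_exp (-e ^ 2)
  nlinarith

/-! ### Potentials for the repeated querying subroutine -/

/-- The threshold `Δ_l` of the stopping rule. -/
noncomputable def threshold (c : ℝ) (l : ℕ) : ℝ := √((l + 1) * Real.log (2 / c) / 2 ^ l)

/-- The exponent in the Chernoff bound for the event that the subroutine stops after batch `l`
with a sum of sign `-σ`. -/
noncomputable def wrongExponent (c σ : ℝ) (l : ℕ) (t : Tally) : ℝ :=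
  2 * threshold c l * (-(σ * t.sum) - 2 * (2 ^ (l + 1) - 1) * threshold c l) +
    2 * threshold c l ^ 2 * ((2 ^ (l + 1) - 1) - t.draws)

/-- The exponent in the Chernoff bound for the event that the subroutine does not stop after
`N` draws although the answer is `true` with probability at least `1 / 2 + e`. -/
noncomputable def slowExponent (e N : ℝ) (t : Tally) : ℝ :=
  e * (e * N / 2 - t.sum) - e ^ 2 * (N - t.draws)

lemma log_two_div_pos {c : ℝ} (h0 : 0 < c) (h1 : c < 1) : 0 < Real.log (2 / c) :=
  Real.log_pos (by rw [lt_div_iff₀ h0]; linarith)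

lemma threshold_sq {c : ℝ} (h0 : 0 < c) (h1 : c < 1) (l : ℕ) :
    threshold c l ^ 2 = (l + 1) * Real.log (2 / c) / 2 ^ l :=
  Real.sq_sqrt (by have := log_two_div_pos h0 h1; positivity)

lemma threshold_pos {c : ℝ} (h0 : 0 < c) (h1 : c < 1) (l : ℕ) : 0 < threshold c l :=
  Real.sqrt_pos.2 (by have := log_two_div_pos h0 h1; positivity)

/-- The tilt of the Chernoff bound is `2 D` with `D = threshold c l`. A draw multiplies the moment
by at most `exp ((2 D) ^ 2 / 2)`, and the term of `wrongExponent` that counts the remaining draws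
pays exactly for this. -/
lemma expect_wrong (P : PMF Bool) {c : ℝ} (b : Bool) (h : 1 / 2 ≤ (P b).toReal)
    (l : ℕ) (t : Tally) :
    expect P (fun a => ENNReal.ofReal
      (Real.exp (wrongExponent c (if b then 1 else -1) l (t.add a)))) ≤
      ENNReal.ofReal (Real.exp (wrongExponent c (if b then 1 else -1) l t)) := by
  rw [expect_bool _ _ fun _ => (Real.exp_pos _).le]
  apply ENNReal.ofReal_le_ofReal
  set D := threshold c l with hD
  have hD0 : 0 ≤ 2 * D := by have : 0 ≤ D := Real.sqrt_nonneg _; linarith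
  have hP := toReal_true_add_false P
  have key : ∀ a, Real.exp (wrongExponent c (if b then 1 else -1) l (t.add a)) =
      Real.exp (wrongExponent c (if b then 1 else -1) l t) *
        (Real.exp (-(2 * D) ^ 2 / 2) * Real.exp (if a = b then -(2 * D) else 2 * D)) := by
    intro a
    rw [← Real.exp_add, ← Real.exp_add]
    congr 1
    unfold wrongExponent Tally.add
    rw [← hD]
    push_cast
    cases a <;> cases b <;> simp <;> ring
  rw [key, key]
  have hE := Real.exp_pos (wrongExponent c (if b then 1 else -1) l t)
  have hone : Real.exp (-(2 * D) ^ 2 / 2) * Real.exp ((2 * D) ^ 2 / 2) = 1 := by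
    rw [← Real.exp_add]; simp; ring
  have hF := Real.exp_pos (-(2 * D) ^ 2 / 2)
  have fin : ∀ z, z ≤ Real.exp ((2 * D) ^ 2 / 2) →
      Real.exp (wrongExponent c (if b then 1 else -1) l t) * (Real.exp (-(2 * D) ^ 2 / 2) * z) ≤
      Real.exp (wrongExponent c (if b then 1 else -1) l t) := by
    intro z hz
    have := mul_le_mul_of_nonneg_left hz hF.le
    rw [hone] at this
    nlinarith
  cases b
  · have := fin _ (exp_moment_wrong (p := (P false).toReal) (p' := (P true).toReal)
      (by linarith) h hD0)
    refine le_trans (le_of_eq ?_) this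
    simp; ring
  · have := fin _ (exp_moment_wrong (p := (P true).toReal) (p' := (P false).toReal)
      (by linarith) h hD0)
    refine le_trans (le_of_eq ?_) this
    simp; ring

lemma expect_slow (P : PMF Bool) {e N : ℝ} (h : 1 / 2 + e ≤ (P true).toReal) (he : 0 < e)
    (he' : e ≤ 1 / 2) (t : Tally) :
    expect P (fun a => ENNReal.ofReal (Real.exp (slowExponent e N (t.add a)))) ≤
      ENNReal.ofReal (Real.exp (slowExponent e N t)) := by
  rw [expect_bool _ _ fun _ => (Real.exp_pos _).le]
  apply ENNReal.ofReal_le_ofReal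
  have hP := toReal_true_add_false P
  have key : ∀ a, Real.exp (slowExponent e N (t.add a)) =
      Real.exp (slowExponent e N t) * (Real.exp (e ^ 2) * Real.exp (if a then -e else e)) := by
    intro a
    rw [← Real.exp_add, ← Real.exp_add]
    congr 1
    unfold slowExponent Tally.add
    push_cast
    cases a <;> simp <;> ring
  rw [key, key]
  have hE := Real.exp_pos (slowExponent e N t)
  have hone : Real.exp (e ^ 2) * Real.exp (-e ^ 2) = 1 := by rw [← Real.exp_add]; simp
  have := mul_le_mul_of_nonneg_left (exp_moment_right hP h he he') (Real.exp_pos (e ^ 2)).le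
  rw [hone] at this
  have := mul_le_mul_of_nonneg_left this hE.le
  refine le_trans (le_of_eq ?_) (this.trans (le_of_eq (mul_one _)))
  simp; ring

/-- The factor `l + 1` in the threshold makes term `l` at most `(c / 2) ^ (l + 1)`, so a union bound
over all batches costs only `c`. -/
lemma wrong_empty {c : ℝ} (h0 : 0 < c) (h1 : c < 1) (σ : ℝ) :
    ∑' l, ENNReal.ofReal (Real.exp (wrongExponent c σ l Tally.empty)) ≤ ENNReal.ofReal c := by
  have hP := log_two_div_pos h0 h1
  have hc2 : Real.exp (-Real.log (2 / c)) = c / 2 := by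
    rw [Real.exp_neg, Real.exp_log (by positivity), inv_div]
  have hterm : ∀ l : ℕ, ENNReal.ofReal (Real.exp (wrongExponent c σ l Tally.empty)) ≤
      ENNReal.ofReal (c / 2) * (2⁻¹ : ℝ≥0∞) ^ l := by
    intro l
    have h2 : (1 : ℝ) ≤ 2 ^ l := one_le_pow₀ (by norm_num)
    have hle : wrongExponent c σ l Tally.empty ≤ (l + 1 : ℕ) * -Real.log (2 / c) := by
      have : wrongExponent c σ l Tally.empty = -(2 * threshold c l ^ 2 * (2 ^ (l + 1) - 1)) := by
        unfold wrongExponent Tally.empty; push_cast; ring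
      rw [this, threshold_sq h0 h1]
      have h3 : (l + 1) * Real.log (2 / c) / 2 ^ l * 2 ^ l = (l + 1) * Real.log (2 / c) := by
        field_simp
      have h4 : 0 ≤ (l + 1) * Real.log (2 / c) / 2 ^ l := by positivity
      have h5 : 0 ≤ (l + 1) * Real.log (2 / c) := by positivity
      push_cast
      rw [pow_succ]
      nlinarith [mul_le_mul_of_nonneg_left h2 h4]
    have h6 : Real.exp (wrongExponent c σ l Tally.empty) ≤ c / 2 * (1 / 2) ^ l := by
      refine (Real.exp_le_exp.2 hle).trans ?_
      rw [Real.exp_nat_mul, hc2, pow_succ, mul_comm]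
      gcongr
    refine (ENNReal.ofReal_le_ofReal h6).trans (le_of_eq ?_)
    rw [ENNReal.ofReal_mul (by positivity), ENNReal.ofReal_pow (by norm_num)]
    congr 2
    rw [one_div, ENNReal.ofReal_inv_of_pos (by norm_num)]
    simp
  refine (ENNReal.tsum_le_tsum hterm).trans ?_
  rw [ENNReal.tsum_mul_left, ENNReal.tsum_geometric, ENNReal.one_sub_inv_two, inv_inv]
  have : (2 : ℝ≥0∞) = ENNReal.ofReal 2 := by simp
  rw [this, ← ENNReal.ofReal_mul (by positivity)]
  apply ENNReal.ofReal_le_ofReal; linarith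

lemma slow_empty {c e : ℝ} (h0 : 0 < c) (h1 : c < 1) {l : ℕ}
    (hl : 16 * ((l + 1) * Real.log (2 / c)) ≤ e ^ 2 * 2 ^ l) :
    ENNReal.ofReal (Real.exp (slowExponent e (2 ^ (l + 1) - 1) Tally.empty)) ≤
      ENNReal.ofReal c := by
  have hP := log_two_div_pos h0 h1
  apply ENNReal.ofReal_le_ofReal
  have hc2 : Real.exp (-Real.log (2 / c)) = c / 2 := by
    rw [Real.exp_neg, Real.exp_log (by positivity), inv_div]
  refine (Real.exp_le_exp.2 (?_ : _ ≤ -Real.log (2 / c))).trans (by rw [hc2]; linarith)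
  have h2 : (1 : ℝ) ≤ 2 ^ l := one_le_pow₀ (by norm_num)
  have : slowExponent e (2 ^ (l + 1) - 1) Tally.empty = -(e ^ 2 * (2 ^ (l + 1) - 1) / 2) := by
    unfold slowExponent Tally.empty; push_cast; ring
  rw [this, pow_succ 2 l]
  have hl0 : (0 : ℝ) ≤ l := Nat.cast_nonneg l
  nlinarith [sq_nonneg e, mul_nonneg hl0 hP.le, mul_le_mul_of_nonneg_left h2 (sq_nonneg e)]

lemma cast_draws {t : Tally} {l : ℕ} (hN : t.draws + 1 = 2 ^ (l + 1)) :
    (t.draws : ℝ) = 2 ^ (l + 1) - 1 := by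
  have : ((t.draws + 1 : ℕ) : ℝ) = ((2 ^ (l + 1) : ℕ) : ℝ) := by rw [hN]
  push_cast at this
  linarith

lemma two_pow_succ_sub_one_pos (l : ℕ) : (0 : ℝ) < 2 ^ (l + 1) - 1 := by
  have : (1 : ℝ) < 2 ^ (l + 1) := one_lt_pow₀ (by norm_num) (by simp)
  linarith

lemma abs_half_mean {t : Tally} {l : ℕ} (hN : t.draws + 1 = 2 ^ (l + 1)) :
    |(1 / 2 : ℝ) * (t.sum / t.draws)| = |(t.sum : ℝ)| / (2 * (2 ^ (l + 1) - 1)) := by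
  have := two_pow_succ_sub_one_pos l
  rw [cast_draws hN, abs_mul, abs_div (t.sum : ℝ), abs_of_pos this,
    abs_of_pos (by norm_num : (0 : ℝ) < 1 / 2)]
  field_simp

lemma wrong_of_stops {c : ℝ} (h0 : 0 < c) (h1 : c < 1) {t : Tally} (ht : t.Stops c) (b : Bool)
    (hb : decide (0 < t.sum) ≠ b) :
    1 ≤ ∑' l, ENNReal.ofReal (Real.exp (wrongExponent c (if b then 1 else -1) l t)) := by
  obtain ⟨l, hN, hl⟩ := ht
  refine le_trans ?_ (ENNReal.le_tsum l)
  rw [← ENNReal.ofReal_one]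
  apply ENNReal.ofReal_le_ofReal
  apply Real.one_le_exp
  have hD := threshold_pos h0 h1 l
  have hN' := two_pow_succ_sub_one_pos l
  rw [abs_half_mean hN, le_div_iff₀ (by linarith)] at hl
  change threshold c l * _ ≤ _ at hl
  have hS : -((if b then 1 else -1 : ℝ) * t.sum) = |(t.sum : ℝ)| := by
    cases b
    · have : (0 : ℝ) ≤ t.sum := by
        simp only [ne_eq, decide_eq_false_iff_not, not_not] at hb; exact_mod_cast hb.le
      simp [abs_of_nonneg this]
    · have : (t.sum : ℝ) ≤ 0 := by
        simp only [ne_eq, decide_eq_true_eq, not_lt] at hb; exact_mod_cast hb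
      simp [abs_of_nonpos this]
  unfold wrongExponent
  rw [cast_draws hN, hS]
  have : 0 ≤ |(t.sum : ℝ)| - 2 * (2 ^ (l + 1) - 1) * threshold c l := by linarith
  have := mul_nonneg (mul_nonneg zero_le_two hD.le) this
  linarith

/-- The batch condition says that the threshold is at most `e / 4`. A comparison that goes on after
`N` draws thus has a sum below `e N / 2`, whereas an advantage `e` makes the expected sum at least
`2 e N`. -/
lemma slow_of_not_stops {c e : ℝ} (h0 : 0 < c) (h1 : c < 1) (he : 0 < e) {t : Tally} {l : ℕ}
    (hN : t.draws + 1 = 2 ^ (l + 1)) (ht : ¬ t.Stops c)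
    (hl : 16 * ((l + 1) * Real.log (2 / c)) ≤ e ^ 2 * 2 ^ l) :
    1 ≤ ENNReal.ofReal (Real.exp (slowExponent e (2 ^ (l + 1) - 1) t)) := by
  rw [← ENNReal.ofReal_one]
  apply ENNReal.ofReal_le_ofReal
  apply Real.one_le_exp
  have hN' := two_pow_succ_sub_one_pos l
  have hD := threshold_pos h0 h1 l
  have hlt : |(t.sum : ℝ)| < threshold c l * (2 * (2 ^ (l + 1) - 1)) := by
    by_contra hcon
    push Not at hcon
    refine ht ⟨l, hN, ?_⟩
    rw [abs_half_mean hN, le_div_iff₀ (by linarith)]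
    exact hcon
  have hDe : threshold c l ≤ e / 4 := by
    apply le_of_sq_le_sq _ (by positivity)
    rw [threshold_sq h0 h1, div_le_iff₀ (by positivity)]
    linarith
  have h3 := le_abs_self (t.sum : ℝ)
  unfold slowExponent
  rw [cast_draws hN]
  have : 0 ≤ e * (2 ^ (l + 1) - 1) / 2 - t.sum := by nlinarith
  have := mul_nonneg he.le this
  linarith


/-! ### Strongly convex functions along coordinate lines -/

/-- The point with step size `α` from `x` along coordinate `i`. -/
noncomputable abbrev along {n : ℕ} (x : E n) (i : Fin n) (α : ℝ) : E n :=
  x + EuclideanSpace.single i α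

section Line
variable {n : ℕ} {τ L : ℝ} {f : E n → ℝ}

lemma along_zero (x : E n) (i : Fin n) : along x i 0 = x := by
  simp [along]

lemma along_sub (x : E n) (i : Fin n) (α β : ℝ) :
    along x i β - along x i α = EuclideanSpace.single i (β - α) := by
  ext j
  by_cases h : j = i <;> simp [along, h]

lemma continuous_along (x : E n) (i : Fin n) : Continuous (along x i) := by
  have : along x i = fun α => x + α • EuclideanSpace.single i (1 : ℝ) := by
    ext α j
    by_cases h : j = i <;> simp [along, h]
  rw [this]
  fun_prop

lemma StronglyConvexSmooth.line_lower (hf : StronglyConvexSmooth τ L f) (x : E n) (i : Fin n)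
    (α β : ℝ) :
    f (along x i α) + gradient f (along x i α) i * (β - α) + τ / 2 * (β - α) ^ 2 ≤
      f (along x i β) := by
  have h := hf.strongly_convex (along x i α) (along x i β)
  rw [norm_sub_rev, along_sub] at h
  rw [EuclideanSpace.inner_single_right] at h
  simpa [mul_comm] using h

/-- Convexity at the far point `β`, with the gradient there replaced by the one at `α`. This costs
the constant `L` instead of `L / 2` but needs no integration; the factor `4 L` in the later decrease
comes from here. -/
lemma StronglyConvexSmooth.line_upper (hτ : 0 < τ) (hf : StronglyConvexSmooth τ L f) (x : E n)
    (i : Fin n) (α β : ℝ) :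
    f (along x i β) ≤
      f (along x i α) + gradient f (along x i α) i * (β - α) + L * (β - α) ^ 2 := by
  have h := hf.line_lower x i β α
  have h1 := hf.lipschitz_gradient (along x i β) (along x i α)
  rw [along_sub, PiLp.norm_single, Real.norm_eq_abs] at h1
  have h2 : |gradient f (along x i β) i - gradient f (along x i α) i| ≤ L * |β - α| := by
    refine le_trans ?_ h1
    have := PiLp.norm_apply_le (gradient f (along x i β) - gradient f (along x i α)) i
    simpa using this
  have h3 : (gradient f (along x i β) i - gradient f (along x i α) i) * (β - α) ≤
      L * (β - α) ^ 2 := by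
    refine (le_abs_self _).trans ?_
    rw [abs_mul, ← sq_abs (β - α), sq, ← mul_assoc]
    gcongr
  nlinarith [sq_nonneg (α - β)]

/-- If `a` lay strictly between `z` and `b`, the slope at `a` would have to be a descent direction
both ways. -/
lemma StronglyConvexSmooth.not_between (hτ : 0 < τ) (hf : StronglyConvexSmooth τ L f) {x : E n}
    {i : Fin n} {a b z : ℝ} (hz : f (along x i z) ≤ f (along x i a))
    (hb : f (along x i b) ≤ f (along x i a)) : 0 ≤ (z - a) * (b - a) := by
  by_contra! hcon
  have h1 := hf.line_lower x i a z
  have h2 := hf.line_lower x i a b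
  set p := gradient f (along x i a) i
  have hz0 : z - a ≠ 0 := by rintro h; simp [h] at hcon
  have hb0 : b - a ≠ 0 := by rintro h; simp [h] at hcon
  have h3 : p * (z - a) < 0 := by
    have : 0 < τ / 2 * (z - a) ^ 2 := by positivity
    linarith
  have h4 : p * (b - a) < 0 := by
    have : 0 < τ / 2 * (b - a) ^ 2 := by positivity
    linarith
  have h5 := mul_pos_of_neg_of_neg h3 h4
  nlinarith [sq_nonneg p]

lemma StronglyConvexSmooth.sq_partial_le (hτ : 0 < τ) (hL : 0 < L)
    (hf : StronglyConvexSmooth τ L f) {m : ℝ} (hm : ∀ y, m ≤ f y) (x : E n) (i : Fin n) :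
    gradient f x i ^ 2 / (4 * L) ≤ f x - m := by
  have h := hf.line_upper hτ x i 0 (-gradient f x i / (2 * L))
  have h2 := hm (along x i (-gradient f x i / (2 * L)))
  rw [along_zero] at h
  have : gradient f x i * (-gradient f x i / (2 * L) - 0) +
      L * (-gradient f x i / (2 * L) - 0) ^ 2 = -(gradient f x i ^ 2 / (4 * L)) := by
    field_simp; ring
  linarith

/-- The Polyak–Łojasiewicz inequality, from completing the square in the strong convexity bound. -/
lemma StronglyConvexSmooth.le_sum_sq_partial (hτ : 0 < τ) (hf : StronglyConvexSmooth τ L f)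
    (x y : E n) : 2 * τ * (f x - f y) ≤ ∑ i, gradient f x i ^ 2 := by
  have h := hf.strongly_convex x y
  have h1 := abs_le.1 (abs_real_inner_le_norm (gradient f x) (y - x))
  have h2 : ∑ i, gradient f x i ^ 2 = ‖gradient f x‖ ^ 2 := by
    rw [EuclideanSpace.norm_sq_eq]; simp
  rw [h2]
  rw [norm_sub_rev x y] at h
  nlinarith [sq_nonneg (‖gradient f x‖ - τ * ‖y - x‖)]

/-- `z` minimizes `f` over the step sizes in `[-B, B]` along coordinate `i` from `x`. -/
def IsLineMin (f : E n → ℝ) (x : E n) (i : Fin n) (B z : ℝ) : Prop :=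
  z ∈ Set.Icc (-B) B ∧ ∀ β ∈ Set.Icc (-B) B, f (along x i z) ≤ f (along x i β)

lemma StronglyConvexSmooth.exists_isLineMin (hf : StronglyConvexSmooth τ L f) (x : E n)
    (i : Fin n) {B : ℝ} (hB : 0 < B) : ∃ z, IsLineMin f x i B z := by
  obtain ⟨z, hz, hz'⟩ := (isCompact_Icc (a := -B) (b := B)).exists_isMinOn
    ⟨0, by constructor <;> linarith⟩
    ((hf.differentiable.continuous.comp (continuous_along x i)).continuousOn)
  exact ⟨z, hz, fun β hβ => hz' hβ⟩

lemma IsLineMin.partial_eq_zero (hτ : 0 < τ) (hL : 0 < L) (hf : StronglyConvexSmooth τ L f)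
    {x : E n} {i : Fin n} {B z : ℝ} (hz : IsLineMin f x i B z) (hzB : |z| < B) :
    gradient f (along x i z) i = 0 := by
  by_contra hp
  set p := gradient f (along x i z) i with hpdef
  have hp' : 0 < |p| := abs_pos.2 hp
  -- A gradient step this short stays in `[-B, B]` and would still lower the value.
  set t := min (1 / (2 * L)) ((B - |z|) / |p|) with ht
  have ht0 : 0 < t := lt_min (by positivity) (div_pos (by linarith) hp')
  have ht1 : t * (2 * L) ≤ 1 := by
    rw [← le_div_iff₀ (by positivity)]; exact min_le_left _ _
  have ht2 : t * |p| ≤ B - |z| := by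
    rw [← le_div_iff₀ hp']; exact min_le_right _ _
  have hmem : z - t * p ∈ Set.Icc (-B) B := by
    have h3 : |z - t * p| ≤ B := by
      refine (abs_sub _ _).trans ?_
      rw [abs_mul, abs_of_pos ht0]; linarith
    exact ⟨(abs_le.1 h3).1, (abs_le.1 h3).2⟩
  have h1 := hz.2 _ hmem
  have h2 := hf.line_upper hτ x i z (z - t * p)
  rw [← hpdef] at h2
  have h4 : 0 < t * p ^ 2 := by positivity
  nlinarith

/-! ### The search interval -/

/-- The part of the search interval that is left after a round. -/
noncomputable def shrink (I : ℝ × ℝ) (d : Decision) : ℝ × ℝ :=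
  if d.second = d.larger then (I.1, I.2 - (I.2 - I.1) / 4) else (I.1 + (I.2 - I.1) / 4, I.2)

/-- The search interval after the rounds with outcomes `H`. -/
noncomputable def interval (B : ℝ) (H : List Decision) : ℝ × ℝ := H.foldl shrink (-B, B)

/-- The midpoint of the search interval is compared with the two quarter points. -/
noncomputable def roundOf (c : Set.Ioo (0 : ℝ) 1) (I : ℝ × ℝ) : Round where
  base := (I.1 + I.2) / 2
  probe₁ := (I.1 + I.2) / 2 - (I.2 - I.1) / 4
  probe₂ := (I.1 + I.2) / 2 + (I.2 - I.1) / 4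
  conf := c
  conf_pos := c.2.1
  conf_lt_one := c.2.2

/-- The final step size: the point of the search interval that is closest to `0`. -/
noncomputable def finalStep (I : ℝ × ℝ) : ℝ := max I.1 (min 0 I.2)

/-- The line search in `[-B, B]` with `R` rounds. -/
noncomputable def lineSearch (c : Set.Ioo (0 : ℝ) 1) (B : ℝ) (R : ℕ) : LineSearch where
  start := roundOf c (interval B [])
  next H := if H.length < R then Sum.inl (roundOf c (interval B H))
    else Sum.inr (finalStep (interval B H))

lemma interval_append (B : ℝ) (H : List Decision) (d : Decision) :
    interval B (H ++ [d]) = shrink (interval B H) d := by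
  simp [interval]

lemma interval_width (B : ℝ) (H : List Decision) :
    (interval B H).2 - (interval B H).1 = 2 * B * (3 / 4) ^ H.length := by
  induction H using List.reverseRecOn with
  | nil => simp [interval]; ring
  | append_singleton H d ih =>
    rw [interval_append, List.length_append, List.length_singleton, pow_succ, ← mul_assoc, ← ih]
    unfold shrink
    split_ifs <;> simp <;> ring

lemma interval_subset {B : ℝ} (hB : 0 < B) (H : List Decision) :
    -B ≤ (interval B H).1 ∧ (interval B H).2 ≤ B := by
  induction H using List.reverseRecOn with
  | nil => simp [interval]
  | append_singleton H d ih =>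
    have hw := interval_width B H
    have : 0 < 2 * B * (3 / 4) ^ H.length := by positivity
    rw [interval_append]
    unfold shrink
    split_ifs <;> constructor <;> simp <;> linarith [ih.1, ih.2]

/-- The probe of a round that belongs to the given subroutine. -/
def Round.probe (r : Round) (b : Bool) : ℝ := if b then r.probe₂ else r.probe₁

/-- Were `z` in the discarded quarter, one of the two compared points would lie strictly between `z`
and the other, and it would have the larger value of the two: this contradicts `not_between`. If the
probe is the smaller one, even half of the interval could go; discarding a quarter in every case
keeps the width independent of the answers. -/
lemma IsLineMin.mem_shrink (hτ : 0 < τ) (hf : StronglyConvexSmooth τ L f) {x : E n}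
    {i : Fin n} {B z : ℝ} (hB : 0 < B) (hz : IsLineMin f x i B z) (c : Set.Ioo (0 : ℝ) 1)
    {H : List Decision}
    (hI : z ∈ Set.Icc (interval B H).1 (interval B H).2) {d : Decision}
    (hd : d.larger = true → f (along x i (roundOf c (interval B H)).base) ≤
      f (along x i ((roundOf c (interval B H)).probe d.second)))
    (hd' : d.larger = false → f (along x i ((roundOf c (interval B H)).probe d.second)) ≤
      f (along x i (roundOf c (interval B H)).base)) :
    z ∈ Set.Icc (interval B (H ++ [d])).1 (interval B (H ++ [d])).2 := by
  have hw := interval_width B H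
  have hw0 : 0 < 2 * B * (3 / 4) ^ H.length := by positivity
  obtain ⟨hs1, hs2⟩ := interval_subset hB H
  rw [interval_append]
  set l := (interval B H).1
  set u := (interval B H).2
  obtain ⟨h1, h2⟩ := hI
  obtain ⟨_ | _, _ | _⟩ := d
  all_goals
    simp only [Round.probe, roundOf, shrink, reduceIte, Bool.false_eq_true, reduceCtorEq,
      forall_const, IsEmpty.forall_iff] at hd hd' ⊢
  · refine ⟨h1, ?_⟩
    by_contra! hcon
    have := hf.not_between hτ (hz.2 ((l + u) / 2) ⟨by linarith, by linarith⟩) hd'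
    nlinarith
  · refine ⟨?_, h2⟩
    by_contra! hcon
    have := hf.not_between hτ
      (hz.2 ((l + u) / 2 - (u - l) / 4) ⟨by linarith, by linarith⟩) hd
    nlinarith
  · refine ⟨?_, h2⟩
    by_contra! hcon
    have := hf.not_between hτ (hz.2 ((l + u) / 2) ⟨by linarith, by linarith⟩) hd'
    nlinarith
  · refine ⟨h1, ?_⟩
    by_contra! hcon
    have := hf.not_between hτ
      (hz.2 ((l + u) / 2 + (u - l) / 4) ⟨by linarith, by linarith⟩) hd
    nlinarith

/-- In every round one of the probes has a much larger value than the base. -/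
lemma StronglyConvexSmooth.exists_gap (hf : StronglyConvexSmooth τ L f) (x : E n) (i : Fin n)
    (c : Set.Ioo (0 : ℝ) 1) (I : ℝ × ℝ) :
    ∃ b, f (along x i (roundOf c I).base) + τ / 2 * ((I.2 - I.1) / 4) ^ 2 ≤
      f (along x i ((roundOf c I).probe b)) := by
  -- The probes are symmetric about the base, so the linear term is nonnegative for at least one of
  -- them.
  have h1 := hf.line_lower x i (roundOf c I).base ((roundOf c I).probe true)
  have h2 := hf.line_lower x i (roundOf c I).base ((roundOf c I).probe false)
  by_contra! hcon
  have h3 := hcon true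
  have h4 := hcon false
  simp only [Round.probe, roundOf, reduceIte, Bool.false_eq_true] at h1 h2 h3 h4
  nlinarith

/-- The chosen step lies between `0` and the minimizer `z`, and convexity bounds its value by the
one at `0`. No gap and no accuracy enter, so this also covers the iterations whose rounds are not
controlled. -/
lemma IsLineMin.finalStep_le (hτ : 0 < τ) (hf : StronglyConvexSmooth τ L f) {x : E n}
    {i : Fin n} {B z : ℝ} (hB : 0 < B) (hz : IsLineMin f x i B z) {I : ℝ × ℝ}
    (hI : z ∈ Set.Icc I.1 I.2) :
    f (along x i (finalStep I)) ≤ f x := by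
  obtain ⟨h1, h2⟩ := hI
  have h0 := hz.2 0 ⟨by linarith, by linarith⟩
  suffices f (along x i (finalStep I)) ≤ f (along x i 0) by rwa [along_zero] at this
  unfold finalStep
  by_contra! hcon
  have h3 := hf.not_between hτ (h0.trans hcon.le) hcon.le
  rcases le_total I.1 0 with h4 | h4
  · rcases le_total 0 I.2 with h5 | h5
    · rw [min_eq_left h5, max_eq_right h4] at hcon
      exact lt_irrefl _ hcon
    · rw [min_eq_right h5, max_eq_right (h1.trans h2)] at h3 hcon
      have h6 : I.2 ≠ 0 := by rintro h; rw [h] at hcon; exact lt_irrefl _ hcon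
      have h7 : z ≠ I.2 := by rintro rfl; linarith
      have h8 : z < I.2 := lt_of_le_of_ne h2 h7
      have h9 : I.2 < 0 := lt_of_le_of_ne h5 h6
      nlinarith
  · rw [min_eq_left (h4.trans (h1.trans h2)), max_eq_left h4] at h3 hcon
    have h6 : I.1 ≠ 0 := by rintro h; rw [h] at hcon; exact lt_irrefl _ hcon
    have h7 : z ≠ I.1 := by rintro rfl; linarith
    have h8 : I.1 < z := lt_of_le_of_ne h1 h7.symm
    have h9 : 0 < I.1 := lt_of_le_of_ne h4 h6.symm
    nlinarith

lemma finalStep_mem {I : ℝ × ℝ} (h : I.1 ≤ I.2) : finalStep I ∈ Set.Icc I.1 I.2 := by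
  unfold finalStep
  exact ⟨le_max_left _ _, max_le h (min_le_right _ _)⟩

/-- The bound `M ≤ L * B ^ 2` puts the gradient step `-g / (2 L)` into the interval, so `z` does at
least as well. The other bound on `M` forces `|z| < B`; the slope at `z` then vanishes, and the
width of `I` enters only quadratically. -/
lemma IsLineMin.finalStep_decrease (hτ : 0 < τ) (hL : 0 < L) (hf : StronglyConvexSmooth τ L f)
    {x : E n} {i : Fin n} {B z m M : ℝ} (hB : 0 < B) (hz : IsLineMin f x i B z) {I : ℝ × ℝ}
    (hI : z ∈ Set.Icc I.1 I.2) (hm : ∀ y, m ≤ f y) (hM : f x - m ≤ M) (hMB : M ≤ L * B ^ 2)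
    (hMB' : 16 * L * M < τ ^ 2 * B ^ 2) :
    f (along x i (finalStep I)) ≤ f x - gradient f x i ^ 2 / (4 * L) + L * (I.2 - I.1) ^ 2 := by
  set g := gradient f x i with hg
  have hgM : g ^ 2 ≤ 4 * L * M := by
    have := (hf.sq_partial_le hτ hL hm x i).trans hM
    rw [div_le_iff₀ (by positivity)] at this
    linarith
  have hzB : |z| < B := by
    have h1 := hf.line_lower x i 0 z
    rw [along_zero, ← hg] at h1
    have h2 := hz.2 0 ⟨by linarith, by linarith⟩
    rw [along_zero] at h2
    apply abs_lt_of_sq_lt_sq _ hB.le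
    have h3 : τ / 2 * z ^ 2 ≤ -(g * z) := by linarith
    have h4 : (τ / 2 * z ^ 2) ^ 2 ≤ (g * z) ^ 2 := by
      rw [← neg_sq (g * z)]
      exact pow_le_pow_left₀ (by positivity) h3 2
    by_contra! hcon
    have hz0 : 0 < z ^ 2 := lt_of_lt_of_le (by positivity) hcon
    have h5 : τ ^ 2 / 4 * z ^ 2 ≤ g ^ 2 := by
      have : (τ ^ 2 / 4 * z ^ 2) * z ^ 2 ≤ g ^ 2 * z ^ 2 := by nlinarith
      exact le_of_mul_le_mul_right this hz0
    have h6 : τ ^ 2 * B ^ 2 ≤ τ ^ 2 * z ^ 2 := by gcongr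
    linarith
  have hstep : f (along x i z) ≤ f x - g ^ 2 / (4 * L) := by
    have h1 := hf.line_upper hτ x i 0 (-g / (2 * L))
    rw [along_zero, ← hg] at h1
    have h2 : g * (-g / (2 * L) - 0) + L * (-g / (2 * L) - 0) ^ 2 = -(g ^ 2 / (4 * L)) := by
      field_simp; ring
    have h3 : |-g / (2 * L)| ≤ B := by
      apply abs_le_of_sq_le_sq _ hB.le
      rw [div_pow, neg_sq, div_le_iff₀ (by positivity)]
      nlinarith
    have h4 := hz.2 (-g / (2 * L)) ⟨(abs_le.1 h3).1, (abs_le.1 h3).2⟩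
    linarith
  have h1 := hf.line_upper hτ x i z (finalStep I)
  rw [hz.partial_eq_zero hτ hL hf hzB] at h1
  have h2 := finalStep_mem (hI.1.trans hI.2)
  have h3 : (finalStep I - z) ^ 2 ≤ (I.2 - I.1) ^ 2 := by
    apply sq_le_sq'
    · linarith [h2.1, hI.2]
    · linarith [h2.2, hI.1]
  have := mul_le_mul_of_nonneg_left h3 hL.le
  linarith

end Line


/-! ### One oracle query -/

/-- The tally of one of the two subroutines. -/
def State.tally {n : ℕ} (s : State n) (b : Bool) : Tally := if b then s.tally₂ else s.tally₁

/-- Replace the tally of one of the two subroutines. -/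
def State.setTally {n : ℕ} (s : State n) (b : Bool) (t : Tally) : State n :=
  if b then { s with tally₂ := t } else { s with tally₁ := t }

/-- The subroutine whose turn it is. -/
def State.side {n : ℕ} (s : State n) : Bool := !decide (s.tally₁.draws ≤ s.tally₂.draws)

/-- The base point of the current round. -/
noncomputable def State.basePoint {n : ℕ} (s : State n) : E n := along s.point s.coord s.round.base

/-- The probe points of the current round. -/
noncomputable def State.probePoint {n : ℕ} (s : State n) (b : Bool) : E n :=
  along s.point s.coord (s.round.probe b)

/-- The state at the beginning of an iteration. -/
def initState {n : ℕ} (A : CoordinateDescent) (k : ℕ) (x : E n) (i : Fin n) : State n :=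
  { point := x, iter := k, coord := i, history := [], round := (A k).start,
    tally₁ := Tally.empty, tally₂ := Tally.empty }

section Step
variable {n : ℕ} [NeZero n]

lemma expect_beginIteration (A : CoordinateDescent) (k : ℕ) (x : E n) (g : State n → ℝ≥0∞) :
    expect (beginIteration A k x) g =
      expect (PMF.uniformOfFintype (Fin n)) fun i => g (initState A k x i) :=
  expect_map _ _ _

open Classical in
lemma expect_step (A : CoordinateDescent) (C : Oracle n) (s : State n) (g : State n → ℝ≥0∞) :
    expect (step A C s) g = expect (C s.basePoint (s.probePoint s.side)) fun a =>
      if ((s.tally s.side).add a).Stops s.round.conf then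
        expect (afterRound A s ⟨s.side, decide (0 < ((s.tally s.side).add a).sum)⟩) g
      else g (s.setTally s.side ((s.tally s.side).add a)) := by
  unfold step
  by_cases h : s.tally₁.draws ≤ s.tally₂.draws
  · have hs : s.side = false := by simp [State.side, h]
    simp only [h, if_true, hs, State.tally, State.setTally, State.basePoint, State.probePoint,
      Round.probe, Bool.false_eq_true, if_false]
    rw [expect_bind]
    congr 1
    funext a
    split_ifs <;> simp [expect_pure]
  · have hs : s.side = true := by simp [State.side, h]
    simp only [h, if_true, hs, State.tally, State.setTally, State.basePoint, State.probePoint,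
      Round.probe, if_false]
    rw [expect_bind]
    congr 1
    funext a
    split_ifs <;> simp [expect_pure]

/-- The state at the beginning of a later round of a line search. -/
noncomputable def nextRoundState (c : Set.Ioo (0 : ℝ) 1) (B : ℝ) (s : State n) (d : Decision) :
    State n :=
  { s with history := s.history ++ [d], round := roundOf c (interval B (s.history ++ [d])),
           tally₁ := Tally.empty, tally₂ := Tally.empty }

lemma expect_afterRound (c : Set.Ioo (0 : ℝ) 1) (B : ℝ) (R : ℕ → ℕ) (s : State n) (d : Decision)
    (g : State n → ℝ≥0∞) :
    expect (afterRound (fun k => lineSearch c B (R k)) s d) g =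
      if s.history.length + 1 < R s.iter then g (nextRoundState c B s d)
      else expect (PMF.uniformOfFintype (Fin n)) fun i =>
        g (initState (fun k => lineSearch c B (R k)) (s.iter + 1)
          (along s.point s.coord (finalStep (interval B (s.history ++ [d])))) i) := by
  unfold afterRound
  by_cases h : s.history.length + 1 < R s.iter
  · simp [lineSearch, h, expect_pure, nextRoundState]
  · simp only [lineSearch, List.length_append, List.length_singleton, h, if_false]
    exact expect_beginIteration _ _ _ _

end Step

/-! ### Killed runs -/

section Killed
variable {n : ℕ}

/-- The runs with `t` queries all of whose transitions are good. -/
def goodRuns (ok : State n → Prop) (good : ℕ → State n → State n → Prop) : ℕ → Set (Run n)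
  | 0 => {r | ok r.1}
  | t + 1 => {r | ∃ s l, r.2 = s :: l ∧ (s, l) ∈ goodRuns ok good t ∧ good t s r.1}

lemma goodRuns_inv {ok : State n → Prop} {good : ℕ → State n → State n → Prop}
    {inv : ℕ → State n → Prop} (hok : ∀ s, ok s → inv 0 s)
    (hgood : ∀ t s s', good t s s' → inv (t + 1) s') {t : ℕ} {r : Run n}
    (hr : r ∈ goodRuns ok good t) : inv t r.1 := by
  cases t with
  | zero => exact hok _ hr
  | succ t => obtain ⟨s, l, _, _, h⟩ := hr; exact hgood _ _ _ h

variable [NeZero n]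

open Classical in
/-- A supermartingale along the good transitions, with a constant payoff once a transition
is not good. -/
lemma expect_goodRuns_le {A : CoordinateDescent} {C : Oracle n} {x₀ : E n}
    {ok : State n → Prop} {good : ℕ → State n → State n → Prop}
    {V : ℕ → State n → ℝ≥0∞} {inv : ℕ → State n → Prop} {e v : ℝ≥0∞} {T : ℕ}
    (hok : ∀ s, ok s → inv 0 s) (hgood : ∀ t s s', good t s s' → inv (t + 1) s')
    (h0 : expect (beginIteration A 0 x₀) (fun s => if ok s then V 0 s else e) ≤ v)
    (hstep : ∀ t s, t < T → inv t s →
      expect (step A C s) (fun s' => if good t s s' then V (t + 1) s' else e) ≤ V t s) :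
    ∀ t, t ≤ T → expect (runLaw A C x₀ t)
      (fun r => if r ∈ goodRuns ok good t then V t r.1 else e) ≤ v := by
  intro t
  induction t with
  | zero =>
    intro _
    refine le_trans (le_of_eq ?_) h0
    exact expect_map _ _ _
  | succ t ih =>
    intro ht
    refine le_trans ?_ (ih (by omega))
    rw [runLaw, expect_bind]
    apply expect_mono
    intro r
    rw [expect_map]
    by_cases hr : r ∈ goodRuns ok good t
    · rw [if_pos hr]
      refine le_trans (expect_mono _ fun s => ?_) (hstep t r.1 (by omega) (goodRuns_inv hok hgood hr))
      by_cases hs : good t r.1 s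
      · rw [if_pos hs, if_pos ⟨r.1, r.2, rfl, hr, hs⟩]
      · rw [if_neg hs, if_neg]
        rintro ⟨s', l, h1, _, h3⟩
        simp only [List.cons.injEq] at h1
        rw [← h1.1] at h3
        exact hs h3
    · rw [if_neg hr]
      apply expect_le_of_le
      intro s
      rw [if_neg]
      rintro ⟨s', l, h1, h2, _⟩
      simp only [List.cons.injEq] at h1
      rw [← h1.1, ← h1.2] at h2
      exact hr h2

end Killed

/-! ### The setting of the analysis -/

/-- The parameters of the analysis: in each of the first `K` iterations, a round is long enough if
one of its subroutines has finished batch `batch k`, since one of the two comparisons has a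
gap `gap k` and thus an advantage `adv k`. -/
structure Setting (n : ℕ) (τ L : ℝ) (f : E n → ℝ) (C : Oracle n) where
  m : ℝ
  M : ℝ
  B : ℝ
  c : Set.Ioo (0 : ℝ) 1
  R : ℕ → ℕ
  K : ℕ
  batch : ℕ → ℕ
  adv : ℕ → ℝ
  gap : ℕ → ℝ
  τ_pos : 0 < τ
  L_pos : 0 < L
  convex : StronglyConvexSmooth τ L f
  le_f : ∀ y, m ≤ f y
  exists_eq : ∃ y, f y = m
  B_pos : 0 < B
  R_pos : ∀ k, 0 < R k
  half_le : ∀ x y, f x ≠ f y → 1 / 2 ≤ (C x y (decide (f x < f y))).toReal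
  adv_pos : ∀ k < K, 0 < adv k
  adv_le : ∀ k < K, adv k ≤ 1 / 2
  le_answer : ∀ k < K, ∀ x y, f x + gap k ≤ f y → 1 / 2 + adv k ≤ (C x y true).toReal
  gap_le : ∀ k < K, gap k ≤ τ / 2 * (B / 2 * (3 / 4) ^ R k) ^ 2
  le_batch : ∀ k < K, 16 * ((batch k + 1) * Real.log (2 / c)) ≤ adv k ^ 2 * 2 ^ batch k
  M_le : 0 < K → M ≤ L * B ^ 2
  M_lt : 0 < K → 16 * L * M < τ ^ 2 * B ^ 2

namespace Setting
variable {n : ℕ} {τ L : ℝ} {f : E n → ℝ} {C : Oracle n} (S : Setting n τ L f C)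

/-- The algorithm. -/
noncomputable def alg : CoordinateDescent := fun k => lineSearch S.c S.B (S.R k)

/-- A bound for the number of queries in an iteration. -/
def cost (k : ℕ) : ℕ := S.R k * 2 ^ (S.batch k + 2)

/-- A bound for the number of queries made so far. -/
def clock (s : State n) : ℕ :=
  ∑ j ∈ Finset.range s.iter, S.cost j + s.history.length * 2 ^ (S.batch s.iter + 2) +
    (s.tally₁.draws + s.tally₂.draws)

/-- The invariants of a good run. -/
structure Inv (t : ℕ) (s : State n) : Prop where
  length_lt : s.history.length < S.R s.iter
  round_eq : s.round = roundOf S.c (interval S.B s.history)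
  draws_le : s.tally₂.draws ≤ s.tally₁.draws
  le_draws : s.tally₁.draws ≤ s.tally₂.draws + 1
  exists_min : ∃ z, IsLineMin f s.point s.coord S.B z ∧
    z ∈ Set.Icc (interval S.B s.history).1 (interval S.B s.history).2
  fast : s.iter < S.K → ∀ b, f s.basePoint + S.gap s.iter ≤ f (s.probePoint b) →
    (s.tally b).draws + 1 < 2 ^ (S.batch s.iter + 1)
  value_le : f s.point - S.m ≤ S.M
  time_le : s.iter < S.K → t ≤ S.clock s

/-- An iteration from `s` ends at `x` with the decrease that the line search promises. -/
def Decrease (s : State n) (x : E n) : Prop :=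
  f x ≤ f s.point ∧ (s.iter < S.K → f x ≤ f s.point - gradient f s.point s.coord ^ 2 / (4 * L) +
    L * (2 * S.B * (3 / 4) ^ S.R s.iter) ^ 2)

/-- A good transition. -/
def Good (t : ℕ) (s s' : State n) : Prop :=
  S.Inv (t + 1) s' ∧ ((s'.point = s.point ∧ s'.iter = s.iter ∧ s'.coord = s.coord) ∨
    (s'.iter = s.iter + 1 ∧ S.Decrease s s'.point))

/-- A decision that does not contradict the values of the objective. -/
def Consistent (f : E n → ℝ) (s : State n) (d : Decision) : Prop :=
  (d.larger = true → f s.basePoint ≤ f (s.probePoint d.second)) ∧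
    (d.larger = false → f (s.probePoint d.second) ≤ f s.basePoint)

/-! ### Good transitions preserve the invariants -/

variable {S}

lemma inv_initState {t k : ℕ} {x : E n} {i : Fin n} (hx : f x - S.m ≤ S.M)
    (ht : k < S.K → t ≤ ∑ j ∈ Finset.range k, S.cost j) :
    S.Inv t (initState S.alg k x i) where
  length_lt := S.R_pos k
  round_eq := rfl
  draws_le := le_rfl
  le_draws := Nat.le_succ _
  exists_min := by
    obtain ⟨z, hz⟩ := S.convex.exists_isLineMin x i S.B_pos
    exact ⟨z, hz, hz.1⟩
  fast := by
    intro _ b _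
    have : (initState S.alg k x i).tally b = Tally.empty := by cases b <;> rfl
    rw [this]
    exact Nat.one_lt_two_pow (by simp)
  value_le := hx
  time_le := fun hk => (ht hk).trans (by simp [clock, initState])

/-- `S.gap` is calibrated to the width after all rounds; the current interval is at least as wide.
-/
lemma Inv.exists_gap {t : ℕ} {s : State n} (h : S.Inv t s) (hk : s.iter < S.K) :
    ∃ b, f s.basePoint + S.gap s.iter ≤ f (s.probePoint b) := by
  obtain ⟨b, hb⟩ := S.convex.exists_gap s.point s.coord S.c (interval S.B s.history)
  refine ⟨b, le_trans ?_ (by simpa only [State.probePoint, h.round_eq] using hb)⟩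
  rw [State.basePoint, h.round_eq]
  gcongr
  refine (S.gap_le _ hk).trans ?_
  rw [interval_width]
  have h1 : ((3 : ℝ) / 4) ^ S.R s.iter ≤ (3 / 4) ^ s.history.length :=
    pow_le_pow_of_le_one (by norm_num) (by norm_num) h.length_lt.le
  have hB := S.B_pos
  have hτ := S.τ_pos
  have h2 : S.B / 2 * (3 / 4) ^ S.R s.iter ≤ 2 * S.B * (3 / 4) ^ s.history.length / 4 := by
    nlinarith
  gcongr

/-- The comparison with the large gap has not completed the decisive batch, and by taking turns the
other one is at most one draw ahead. -/
lemma Inv.draws_lt {t : ℕ} {s : State n} (h : S.Inv t s) (hk : s.iter < S.K) :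
    s.tally₁.draws + s.tally₂.draws + 1 ≤ 2 ^ (S.batch s.iter + 2) := by
  obtain ⟨b, hb⟩ := h.exists_gap hk
  have h1 := h.fast hk b hb
  have h2 := h.draws_le
  have h3 := h.le_draws
  rw [pow_succ] at h1 ⊢
  rw [pow_succ]
  cases b <;> simp only [State.tally, Bool.false_eq_true, if_false, if_true] at h1 <;> omega

/-- A nonfinal draw can spoil the invariants only by completing the decisive batch of a comparison
with a large gap. -/
lemma Inv.good_setTally {t : ℕ} {s : State n} (h : S.Inv t s) (a : Bool)
    (ha : s.iter < S.K → f s.basePoint + S.gap s.iter ≤ f (s.probePoint s.side) →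
      ((s.tally s.side).add a).draws + 1 ≠ 2 ^ (S.batch s.iter + 1)) :
    S.Good t s (s.setTally s.side ((s.tally s.side).add a)) := by
  have h2 := h.draws_le
  have h3 := h.le_draws
  by_cases hs : s.tally₁.draws ≤ s.tally₂.draws
  · have hside : s.side = false := by simp [State.side, hs]
    rw [hside] at ha ⊢
    simp only [State.setTally, State.tally, Bool.false_eq_true, if_false] at ha ⊢
    refine ⟨⟨h.length_lt, h.round_eq, ?_, ?_, h.exists_min, ?_, h.value_le, ?_⟩,
      Or.inl ⟨rfl, rfl, rfl⟩⟩
    · simp only [Tally.add]; omega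
    · simp only [Tally.add]; omega
    · intro hk b hb
      have h4 := h.fast hk b hb
      cases b
      · have h5 := ha hk hb
        simp only [State.tally, Bool.false_eq_true, if_false, Tally.add] at h4 h5 ⊢
        omega
      · exact h4
    · intro hk
      have := h.time_le hk
      simp only [clock, Tally.add] at this ⊢
      omega
  · have hside : s.side = true := by simp [State.side, hs]
    rw [hside] at ha ⊢
    simp only [State.setTally, State.tally, if_true] at ha ⊢
    refine ⟨⟨h.length_lt, h.round_eq, ?_, ?_, h.exists_min, ?_, h.value_le, ?_⟩,
      Or.inl ⟨rfl, rfl, rfl⟩⟩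
    · simp only [Tally.add]; omega
    · simp only [Tally.add]; omega
    · intro hk b hb
      have h4 := h.fast hk b hb
      cases b
      · exact h4
      · have h5 := ha hk hb
        simp only [State.tally, if_true, Tally.add] at h4 h5 ⊢
        omega
    · intro hk
      have := h.time_le hk
      simp only [clock, Tally.add] at this ⊢
      omega

lemma Inv.mem_interval {t : ℕ} {s : State n} (h : S.Inv t s) {d : Decision}
    (hd : Consistent f s d) : ∃ z, IsLineMin f s.point s.coord S.B z ∧
    z ∈ Set.Icc (interval S.B (s.history ++ [d])).1 (interval S.B (s.history ++ [d])).2 := by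
  obtain ⟨z, hz, hI⟩ := h.exists_min
  obtain ⟨h1, h2⟩ := hd
  unfold State.basePoint State.probePoint at h1 h2
  rw [h.round_eq] at h1 h2
  exact ⟨z, hz, hz.mem_shrink S.τ_pos S.convex S.B_pos S.c hI h1 h2⟩

lemma Inv.good_nextRound {t : ℕ} {s : State n} (h : S.Inv t s) {d : Decision}
    (hd : Consistent f s d) (hR : s.history.length + 1 < S.R s.iter) :
    S.Good t s (nextRoundState S.c S.B s d) := by
  refine ⟨⟨by simpa [nextRoundState] using hR, rfl, le_rfl, Nat.le_succ _, h.mem_interval hd,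
    ?_, h.value_le, ?_⟩, Or.inl ⟨rfl, rfl, rfl⟩⟩
  · intro _ b _
    have : (nextRoundState S.c S.B s d).tally b = Tally.empty := by cases b <;> rfl
    rw [this]
    exact Nat.one_lt_two_pow (by simp)
  · intro hk
    have h1 := h.time_le hk
    have h2 := h.draws_lt hk
    simp only [clock, nextRoundState, List.length_append, List.length_singleton, Tally.empty,
      add_mul, one_mul] at h1 h2 ⊢
    omega

lemma Inv.good_initState {t : ℕ} {s : State n} (h : S.Inv t s) {d : Decision}
    (hd : Consistent f s d) (hR : ¬ s.history.length + 1 < S.R s.iter) (i : Fin n) :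
    S.Good t s (initState S.alg (s.iter + 1)
      (along s.point s.coord (finalStep (interval S.B (s.history ++ [d])))) i) := by
  obtain ⟨z, hz, hI⟩ := h.mem_interval hd
  have hlen : s.history.length + 1 = S.R s.iter := by have := h.length_lt; omega
  have hle := hz.finalStep_le S.τ_pos S.convex S.B_pos hI
  refine ⟨inv_initState (by linarith [h.value_le]) ?_, Or.inr ⟨rfl, hle, ?_⟩⟩
  · intro hk
    have h1 := h.time_le (by omega)
    have h2 := h.draws_lt (by omega)
    rw [Finset.sum_range_succ, cost, ← hlen, add_mul, one_mul]
    simp only [clock] at h1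
    omega
  · intro hk
    have := hz.finalStep_decrease S.τ_pos S.L_pos S.convex S.B_pos hI S.le_f h.value_le
      (S.M_le (by omega)) (S.M_lt (by omega))
    rwa [interval_width, List.length_append, List.length_singleton, hlen] at this

/-! ### The probability of a good run -/

open Classical in
/-- The potential of one comparison in iteration `k`. -/
noncomputable def pot (S : Setting n τ L f C) (k : ℕ) (x y : E n) (t : Tally) : ℝ≥0∞ :=
  (if f x = f y then 0 else ∑' l, ENNReal.ofReal
    (Real.exp (wrongExponent S.c (if decide (f x < f y) then 1 else -1) l t))) +
  (if k < S.K ∧ f x + S.gap k ≤ f y then ENNReal.ofReal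
    (Real.exp (slowExponent (S.adv k) (2 ^ (S.batch k + 1) - 1) t)) else 0)

lemma pot_empty (k : ℕ) (x y : E n) : S.pot k x y Tally.empty ≤ 2 * ENNReal.ofReal S.c := by
  rw [two_mul]
  unfold pot
  gcongr
  · split_ifs
    · exact zero_le
    · exact wrong_empty S.c.2.1 S.c.2.2 _
    · exact wrong_empty S.c.2.1 S.c.2.2 _
  · split_ifs with h
    · exact slow_empty S.c.2.1 S.c.2.2 (S.le_batch _ h.1)
    · exact zero_le

lemma expect_pot_le (k : ℕ) (x y : E n) (t : Tally) :
    expect (C x y) (fun a => S.pot k x y (t.add a)) ≤ S.pot k x y t := by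
  unfold pot
  rw [expect_add]
  gcongr
  · by_cases h : f x = f y
    · simp only [h, if_true]; exact (expect_const _ _).le
    · simp only [h, if_false]
      rw [expect_tsum]
      exact ENNReal.tsum_le_tsum fun l => expect_wrong _ _ (S.half_le x y h) l t
  · by_cases h : k < S.K ∧ f x + S.gap k ≤ f y
    · simp only [h, and_self, if_true]
      exact expect_slow _ (S.le_answer k h.1 x y h.2) (S.adv_pos k h.1) (S.adv_le k h.1) t
    · simp only [h, if_false]; exact (expect_const _ _).le

lemma one_le_pot_of_wrong {k : ℕ} {x y : E n} {t : Tally} (ht : t.Stops S.c) (h : f x ≠ f y)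
    (hd : decide (0 < t.sum) ≠ decide (f x < f y)) : 1 ≤ S.pot k x y t := by
  unfold pot
  rw [if_neg h]
  exact (wrong_of_stops S.c.2.1 S.c.2.2 ht _ hd).trans le_self_add

lemma one_le_pot_of_slow {k : ℕ} {x y : E n} {t : Tally} (ht : ¬ t.Stops S.c) (hk : k < S.K)
    (h : f x + S.gap k ≤ f y) (hN : t.draws + 1 = 2 ^ (S.batch k + 1)) : 1 ≤ S.pot k x y t := by
  unfold pot
  rw [if_pos (⟨hk, h⟩ : k < S.K ∧ f x + S.gap k ≤ f y)]
  exact (slow_of_not_stops S.c.2.1 S.c.2.2 (S.adv_pos k hk) hN ht (S.le_batch k hk)).trans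
    le_add_self

/-- The potential of the comparisons of the current round. -/
noncomputable def sidePot (S : Setting n τ L f C) (s : State n) (b : Bool) : ℝ≥0∞ :=
  S.pot s.iter s.basePoint (s.probePoint b) (s.tally b)

/-- The failure potential when `j` further queries remain. -/
noncomputable def failPot (S : Setting n τ L f C) (j : ℕ) (s : State n) : ℝ≥0∞ :=
  j * (4 * ENNReal.ofReal S.c) + (S.sidePot s false + S.sidePot s true)

lemma failPot_eq (j : ℕ) (s : State n) (b : Bool) : S.failPot j s =
    j * (4 * ENNReal.ofReal S.c) + (S.sidePot s (!b) + S.sidePot s b) := by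
  cases b
  · rw [failPot, add_comm (S.sidePot s false)]; rfl
  · rfl

/-- A query starts at most one new round, whose two comparisons carry potential at most `2 c` each.
The `4 c` reserved for that query pays for them. -/
lemma failPot_fresh {j : ℕ} {s : State n} (h : ∀ b, s.tally b = Tally.empty) :
    S.failPot j s ≤ (j + 1 : ℕ) * (4 * ENNReal.ofReal S.c) := by
  have h1 : ∀ b, S.sidePot s b ≤ 2 * ENNReal.ofReal S.c := by
    intro b
    unfold sidePot
    rw [h b]
    exact pot_empty _ _ _
  unfold failPot
  push_cast
  rw [add_mul, one_mul]
  gcongr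
  refine (add_le_add (h1 _) (h1 _)).trans (le_of_eq ?_)
  rw [← add_mul]
  norm_num

lemma failPot_setTally (j : ℕ) (s : State n) (b : Bool) (t : Tally) :
    S.failPot j (s.setTally b t) = j * (4 * ENNReal.ofReal S.c) +
      (S.sidePot s (!b) + S.pot s.iter s.basePoint (s.probePoint b) t) := by
  rw [failPot_eq j _ b]
  cases b <;> rfl

section Failure
variable [NeZero n]

lemma expect_afterRound_alg (s : State n) (d : Decision) (g : State n → ℝ≥0∞) :
    expect (afterRound S.alg s d) g =
      if s.history.length + 1 < S.R s.iter then g (nextRoundState S.c S.B s d)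
      else expect (PMF.uniformOfFintype (Fin n)) fun i => g (initState S.alg (s.iter + 1)
        (along s.point s.coord (finalStep (interval S.B (s.history ++ [d])))) i) :=
  expect_afterRound _ _ _ _ _ _

-- A query kills the run only through a wrong sign or a late stop, and the potential of the
-- comparison just queried is then at least `1`. A correct stop drops the old potentials and spends
-- `4 c` on the next round. Otherwise the Chernoff supermartingale of that comparison continues.
open Classical in
lemma Inv.expect_step_failPot {t j : ℕ} {s : State n} (h : S.Inv t s) :
    expect (step S.alg C s) (fun s' => if S.Good t s s' then S.failPot j s' else 1) ≤
      S.failPot (j + 1) s := by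
  rw [expect_step]
  set b := s.side with hb
  set g : State n → ℝ≥0∞ := fun s' => if S.Good t s s' then S.failPot j s' else 1 with hg
  have hconf : s.round.conf = S.c := by rw [h.round_eq]; rfl
  have fresh : ∀ d : Decision, (∀ b', (nextRoundState S.c S.B s d).tally b' = Tally.empty) :=
    fun d b' => by cases b' <;> rfl
  have fresh' : ∀ k x i, (∀ b', (initState S.alg k x i : State n).tally b' = Tally.empty) :=
    fun k x i b' => by cases b' <;> rfl
  -- A wrong decision may happen to lead to a good state, so both values of `g` are covered.
  have bound_any : ∀ d : Decision, expect (afterRound S.alg s d) g ≤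
      max 1 ((j + 1 : ℕ) * (4 * ENNReal.ofReal S.c)) := by
    intro d
    have hle : ∀ s' : State n, (∀ b', s'.tally b' = Tally.empty) →
        g s' ≤ max 1 ((j + 1 : ℕ) * (4 * ENNReal.ofReal S.c)) := by
      intro s' hs'
      simp only [hg]
      split_ifs
      · exact (failPot_fresh hs').trans (le_max_right _ _)
      · exact le_max_left _ _
    rw [expect_afterRound_alg]
    split_ifs
    · exact hle _ (fresh d)
    · exact expect_le_of_le _ fun i => hle _ (fresh' _ _ i)
  have bound_right : ∀ d : Decision, Consistent f s d → expect (afterRound S.alg s d) g ≤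
      (j + 1 : ℕ) * (4 * ENNReal.ofReal S.c) := by
    intro d hd
    rw [expect_afterRound_alg]
    split_ifs with hR
    · simp only [hg]
      rw [if_pos (h.good_nextRound hd hR)]
      exact failPot_fresh (fresh d)
    · refine expect_le_of_le _ fun i => ?_
      simp only [hg]
      rw [if_pos (h.good_initState hd hR i)]
      exact failPot_fresh (fresh' _ _ i)
  have main : ∀ a, (if ((s.tally b).add a).Stops s.round.conf then
        expect (afterRound S.alg s ⟨b, decide (0 < ((s.tally b).add a).sum)⟩) g
      else g (s.setTally b ((s.tally b).add a))) ≤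
      ((j + 1 : ℕ) * (4 * ENNReal.ofReal S.c) + S.sidePot s (!b)) +
        S.pot s.iter s.basePoint (s.probePoint b) ((s.tally b).add a) := by
    intro a
    set t' := (s.tally b).add a with ht'
    rw [hconf]
    by_cases hdone : t'.Stops S.c
    · rw [if_pos hdone]
      by_cases hwrong : f s.basePoint ≠ f (s.probePoint b) ∧
          decide (0 < t'.sum) ≠ decide (f s.basePoint < f (s.probePoint b))
      · have h1 : 1 ≤ S.pot s.iter s.basePoint (s.probePoint b) t' :=
          one_le_pot_of_wrong hdone hwrong.1 hwrong.2
        refine (bound_any _).trans (max_le (h1.trans le_add_self) ?_)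
        rw [add_assoc]
        exact le_self_add
      · refine (bound_right _ ?_).trans (by rw [add_assoc]; exact le_self_add)
        rcases eq_or_ne (f s.basePoint) (f (s.probePoint b)) with heq | hne
        · exact ⟨fun _ => heq.le, fun _ => heq.ge⟩
        · have h2 : decide (0 < t'.sum) = decide (f s.basePoint < f (s.probePoint b)) := by
            by_contra hcon
            exact hwrong ⟨hne, hcon⟩
          constructor
          · intro h3
            simp only at h3
            rw [h2, decide_eq_true_eq] at h3
            exact h3.le
          · intro h3
            simp only at h3
            rw [h2, decide_eq_false_iff_not, not_lt] at h3
            exact h3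
    · rw [if_neg hdone]
      simp only [hg]
      split_ifs with hgood
      · rw [failPot_setTally, ← add_assoc]
        gcongr
        exact Nat.le_succ j
      · have hslow : s.iter < S.K ∧ f s.basePoint + S.gap s.iter ≤ f (s.probePoint b) ∧
            t'.draws + 1 = 2 ^ (S.batch s.iter + 1) := by
          by_contra hcon
          exact hgood (h.good_setTally a fun h1 h2 h3 => hcon ⟨h1, h2, h3⟩)
        exact (one_le_pot_of_slow hdone hslow.1 hslow.2.1 hslow.2.2).trans le_add_self
  refine (expect_mono _ main).trans ?_
  rw [expect_add, expect_const, failPot_eq (j + 1) s b, ← add_assoc]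
  gcongr
  exact expect_pot_le _ _ _ _

end Failure

/-! ### The mean value after a good run -/

/-- The error in the value that one line search may leave. -/
noncomputable def slack (S : Setting n τ L f C) (k : ℕ) : ℝ :=
  L * (2 * S.B * (3 / 4) ^ S.R k) ^ 2

/-- A bound for the expected error after iteration `K`, given the error `v` after iteration
`k ≤ K`, a contraction factor `r`, and a bound `bd` for the expected errors. -/
noncomputable def forecast (S : Setting n τ L f C) (r : ℝ) (bd : ℕ → ℝ) (k : ℕ) (v : ℝ) : ℝ :=
  if k < S.K then r ^ (S.K - k) * (v - bd k) + bd S.K else v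

/-- The value potential. -/
noncomputable def valPot (S : Setting n τ L f C) (r : ℝ) (bd : ℕ → ℝ) (s : State n) : ℝ≥0∞ :=
  ENNReal.ofReal (if s.iter < S.K then
    S.forecast r bd (s.iter + 1)
      (f s.point - gradient f s.point s.coord ^ 2 / (4 * L) + S.slack s.iter - S.m)
    else f s.point - S.m)

/-- The recursion for bounds of the expected errors, with rate `ρ`. -/
structure IsBound (S : Setting n τ L f C) (ρ : ℝ) (bd : ℕ → ℝ) : Prop where
  pos : 0 < ρ
  le_one : ρ ≤ 1
  le_div : ρ ≤ τ / (2 * L)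
  nonneg : 0 ≤ bd 0
  M_le : S.M ≤ bd 0
  rec_le : ∀ k < S.K, (1 - ρ / n) * bd k + S.slack k ≤ bd (k + 1)

lemma slack_nonneg (k : ℕ) : 0 ≤ S.slack k := by
  have := S.L_pos
  unfold slack; positivity

lemma forecast_le {r : ℝ} (hr : 0 ≤ r) (bd : ℕ → ℝ) (k : ℕ) {v w : ℝ} (h : v ≤ w) :
    S.forecast r bd k v ≤ S.forecast r bd k w := by
  unfold forecast
  split_ifs
  · gcongr
  · exact h

lemma forecast_eq {r : ℝ} {bd : ℕ → ℝ} {k : ℕ} (hk : k ≤ S.K) (v : ℝ) :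
    S.forecast r bd k v = r ^ (S.K - k) * (v - bd k) + bd S.K := by
  unfold forecast
  split_ifs with h
  · rfl
  · have : k = S.K := by omega
    subst this
    simp

variable [NeZero n]

section Bound
variable {ρ : ℝ} {bd : ℕ → ℝ}

lemma IsBound.rate_nonneg (h : S.IsBound ρ bd) : 0 ≤ 1 - ρ / n := by
  have hn : (1 : ℝ) ≤ n := by exact_mod_cast NeZero.one_le
  have : ρ / n ≤ 1 := by
    rw [div_le_one (by linarith)]; linarith [h.le_one]
  linarith

lemma IsBound.pow_mul_le (h : S.IsBound ρ bd) (k : ℕ) :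
    ∀ j, k + j ≤ S.K → (1 - ρ / n) ^ j * bd k ≤ bd (k + j) := by
  intro j
  induction j with
  | zero => intro _; simp
  | succ j ih =>
    intro hj
    have h1 := h.rec_le (k + j) (by omega)
    have h2 := mul_le_mul_of_nonneg_left (ih (by omega)) h.rate_nonneg
    have h3 := S.slack_nonneg (k + j)
    rw [pow_succ', mul_assoc, ← add_assoc]
    linarith

lemma IsBound.forecast_nonneg (h : S.IsBound ρ bd) {k : ℕ} (hk : k ≤ S.K) {v : ℝ} (hv : 0 ≤ v) :
    0 ≤ S.forecast (1 - ρ / n) bd k v := by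
  rw [forecast_eq hk]
  have h1 := h.pow_mul_le k (S.K - k) (by omega)
  rw [show k + (S.K - k) = S.K by omega] at h1
  have h2 := mul_nonneg (pow_nonneg h.rate_nonneg (S.K - k)) hv
  nlinarith

/-- The forecast is affine in the value, so averaging over the coordinate amounts to averaging the
squared partial derivatives. Their sum contracts the error by `1 - ρ / n`, and `rec_le` absorbs the
slack. -/
lemma IsBound.expect_init (h : S.IsBound ρ bd) (A : CoordinateDescent) (k : ℕ) (x : E n) :
    expect (PMF.uniformOfFintype (Fin n))
      (fun i => S.valPot (1 - ρ / n) bd (initState A k x i)) ≤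
      ENNReal.ofReal (S.forecast (1 - ρ / n) bd k (f x - S.m)) := by
  have hn : (0 : ℝ) < n := by exact_mod_cast NeZero.pos n
  have hL := S.L_pos
  have hr := h.rate_nonneg
  by_cases hk : k < S.K
  · simp only [valPot, initState, hk, if_true]
    have hpart : ∀ i, gradient f x i ^ 2 / (4 * L) ≤ f x - S.m :=
      S.convex.sq_partial_le S.τ_pos S.L_pos S.le_f x
    rw [expect_uniform _ fun i => h.forecast_nonneg (by omega)
      (by linarith [hpart i, S.slack_nonneg k])]
    apply ENNReal.ofReal_le_ofReal
    obtain ⟨y, hy⟩ := S.exists_eq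
    have hs := S.convex.le_sum_sq_partial S.τ_pos x y
    rw [hy] at hs
    set s2 := ∑ i, gradient f x i ^ 2 with hs2
    have hdec : ρ / n * (f x - S.m) ≤ s2 / (4 * L) / n := by
      rw [div_mul_eq_mul_div]
      gcongr
      have hF : 0 ≤ f x - S.m := by linarith [S.le_f x]
      refine (mul_le_mul_of_nonneg_right h.le_div hF).trans ?_
      rw [div_mul_eq_mul_div, div_le_div_iff₀ (by positivity) (by positivity)]
      nlinarith
    have hsum : (∑ i, S.forecast (1 - ρ / n) bd (k + 1)
        (f x - gradient f x i ^ 2 / (4 * L) + S.slack k - S.m)) / n =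
        S.forecast (1 - ρ / n) bd (k + 1) (f x - s2 / (4 * L) / n + S.slack k - S.m) := by
      simp only [forecast_eq (Nat.succ_le_of_lt hk)]
      rw [Finset.sum_add_distrib, ← Finset.mul_sum]
      simp only [Finset.sum_sub_distrib, Finset.sum_add_distrib, Finset.sum_const,
        Finset.card_univ, Fintype.card_fin, nsmul_eq_mul]
      rw [← Finset.sum_div, ← hs2]
      field_simp
    rw [hsum, forecast_eq (Nat.succ_le_of_lt hk), forecast_eq hk.le,
      show S.K - k = (S.K - (k + 1)) + 1 by omega, pow_succ, mul_assoc]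
    have := h.rec_le k hk
    gcongr
    nlinarith
  · simp only [valPot, initState, hk, if_false]
    rw [expect_const, forecast, if_neg hk]

-- During a line search the coordinate is already drawn and `valPot` counts the promised decrease in
-- advance, so it stays constant. At the end of the iteration the promise is kept on good
-- transitions, and the fresh coordinate is averaged by `expect_init`.
open Classical in
lemma IsBound.expect_step_valPot (h : S.IsBound ρ bd) {t : ℕ} {s : State n} :
    expect (step S.alg C s)
      (fun s' => if S.Good t s s' then S.valPot (1 - ρ / n) bd s' else 0) ≤
      S.valPot (1 - ρ / n) bd s := by
  rw [expect_step]
  apply expect_le_of_le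
  intro a
  have same : ∀ s' : State n, s'.point = s.point → s'.iter = s.iter → s'.coord = s.coord →
      (if S.Good t s s' then S.valPot (1 - ρ / n) bd s' else 0) ≤
        S.valPot (1 - ρ / n) bd s := by
    intro s' h1 h2 h3
    split_ifs
    · unfold valPot; rw [h1, h2, h3]
    · exact zero_le
  set finished := ((s.tally s.side).add a).Stops s.round.conf
  by_cases hdone : finished
  · rw [if_pos hdone, expect_afterRound_alg]
    by_cases hR : s.history.length + 1 < S.R s.iter
    · rw [if_pos hR]
      exact same _ rfl rfl rfl
    · rw [if_neg hR]
      set x' := along s.point s.coord (finalStep (interval S.B (s.history ++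
        [⟨s.side, decide (0 < ((s.tally s.side).add a).sum)⟩])))
      by_cases hD : S.Decrease s x'
      · refine le_trans (expect_mono _ fun i => ?_) ((h.expect_init S.alg (s.iter + 1) x').trans ?_)
        · split_ifs
          · exact le_rfl
          · exact zero_le
        · apply ENNReal.ofReal_le_ofReal
          by_cases hk : s.iter < S.K
          · rw [if_pos hk]
            apply forecast_le h.rate_nonneg
            have := hD.2 hk
            unfold slack
            linarith
          · rw [if_neg hk, forecast, if_neg (by omega)]
            linarith [hD.1]
      · refine expect_le_of_le _ fun i => ?_
        rw [if_neg]
        · exact zero_le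
        · rintro ⟨_, ⟨_, h2, _⟩ | ⟨_, h2⟩⟩
          · simp [initState] at h2
          · exact hD h2
  · rw [if_neg hdone]
    apply same <;> cases s.side <;> rfl

/-- With high probability a run is good, and the mean error over the good runs is small. -/
theorem IsBound.exists_event (h : S.IsBound ρ bd) {T : ℕ} {δ : ℝ} {x₀ : E n}
    (hT : ∑ k ∈ Finset.range S.K, S.cost k ≤ T) (hx : f x₀ - S.m ≤ S.M) (hδ : 0 < δ)
    (hδ' : δ < 1) (hc : 8 * (T + 1) * (S.c : ℝ) ≤ δ) :
    ∃ A : Set (Run n), ENNReal.ofReal (1 - δ) ≤ (runLaw S.alg C x₀ T).toOuterMeasure A ∧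
      condMean (runLaw S.alg C x₀ T) A (fun r => ENNReal.ofReal (f r.estimate - S.m)) ≤
        ENNReal.ofReal (2 * bd S.K) := by
  classical
  set P := runLaw S.alg C x₀ T with hP
  set A : Set (Run n) := goodRuns (S.Inv 0) S.Good T with hA
  have hinit : ∀ i, S.Inv 0 (initState S.alg 0 x₀ i) := fun i => inv_initState hx (by simp)
  have hgood : ∀ t s s', S.Good t s s' → S.Inv (t + 1) s' := fun _ _ _ h => h.1
  have hc0 : 0 < (S.c : ℝ) := S.c.2.1
  have hfail : expect P (fun r => if r ∈ A then S.failPot (T - T) r.1 else 1) ≤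
      ENNReal.ofReal (δ / 2) := by
    refine expect_goodRuns_le (V := fun t s => S.failPot (T - t) s) (T := T) (fun _ h => h) hgood
      ?_ ?_ T le_rfl
    · rw [expect_beginIteration]
      apply expect_le_of_le
      intro i
      rw [if_pos (hinit i)]
      refine (failPot_fresh fun b => by cases b <;> rfl).trans ?_
      rw [← ENNReal.ofReal_natCast, show (4 : ℝ≥0∞) = ENNReal.ofReal 4 by simp,
        ← ENNReal.ofReal_mul (by norm_num), ← ENNReal.ofReal_mul (by positivity)]
      apply ENNReal.ofReal_le_ofReal
      push_cast
      simp only [tsub_zero]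
      linarith
    · intro t s ht hs
      rw [show T - t = (T - (t + 1)) + 1 by omega]
      exact hs.expect_step_failPot
  have hval : expect P (fun r => if r ∈ A then S.valPot (1 - ρ / n) bd r.1 else 0) ≤
      ENNReal.ofReal (bd S.K) := by
    refine expect_goodRuns_le (V := fun _ s => S.valPot (1 - ρ / n) bd s) (T := T) (fun _ h => h)
      hgood ?_ (fun t s _ _ => h.expect_step_valPot) T le_rfl
    rw [expect_beginIteration]
    refine (expect_mono _ fun i => ?_).trans ((h.expect_init S.alg 0 x₀).trans ?_)
    · rw [if_pos (hinit i)]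
    · apply ENNReal.ofReal_le_ofReal
      rw [forecast_eq (Nat.zero_le _)]
      have h1 := pow_nonneg h.rate_nonneg (S.K - 0)
      nlinarith [h.M_le]
  have hsum : P.toOuterMeasure A + expect P (fun r => if r ∈ A then 0 else 1) = 1 := by
    rw [PMF.toOuterMeasure_apply, expect, ← ENNReal.tsum_add, ← P.tsum_coe]
    congr 1
    funext r
    by_cases hr : r ∈ A <;> simp [hr]
  have hbad : expect P (fun r => if r ∈ A then 0 else 1) ≤ ENNReal.ofReal (δ / 2) := by
    refine (expect_mono _ fun r => ?_).trans hfail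
    split_ifs
    · exact zero_le
    · exact le_rfl
  have hPA : ENNReal.ofReal (1 - δ / 2) ≤ P.toOuterMeasure A := by
    rw [ENNReal.ofReal_sub _ (by linarith), ENNReal.ofReal_one, tsub_le_iff_right, ← hsum]
    gcongr
  refine ⟨A, (ENNReal.ofReal_le_ofReal (by linarith)).trans hPA, ?_⟩
  have hnum : (∑' r, A.indicator (fun r => P r * ENNReal.ofReal (f r.estimate - S.m)) r) ≤
      ENNReal.ofReal (bd S.K) := by
    refine le_trans (le_of_eq ?_) hval
    unfold expect
    congr 1
    funext r
    by_cases hr : r ∈ A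
    · have hinv : S.Inv T r.1 := goodRuns_inv (fun _ h => h) hgood hr
      -- Before iteration `K` the clock stays below the total cost of the first `K` iterations,
      -- which is at most `T`, although it bounds the number `T` of queries made.
      have hK : ¬ r.1.iter < S.K := by
        intro hlt
        have h1 := hinv.time_le hlt
        have h2 := hinv.draws_lt hlt
        have h3 := hinv.length_lt
        have h4 : ∑ j ∈ Finset.range (r.1.iter + 1), S.cost j ≤
            ∑ j ∈ Finset.range S.K, S.cost j :=
          Finset.sum_le_sum_of_subset (Finset.range_mono hlt)
        have h5 : (r.1.history.length + 1) * 2 ^ (S.batch r.1.iter + 2) ≤ S.cost r.1.iter :=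
          Nat.mul_le_mul_right _ h3
        rw [Finset.sum_range_succ] at h4
        rw [add_mul, one_mul] at h5
        simp only [clock] at h1
        omega
      simp only [Set.indicator_of_mem hr, if_pos hr, valPot, if_neg hK, Run.estimate]
    · simp [hr]
  unfold condMean
  -- The event has probability at least `1 - δ / 2 ≥ 1 / 2`; conditioning at most doubles the mean,
  -- hence the factor `2` in the conclusion.
  have hhalf : (2 : ℝ≥0∞)⁻¹ ≤ P.toOuterMeasure A := by
    refine le_trans ?_ hPA
    rw [show (2 : ℝ≥0∞)⁻¹ = ENNReal.ofReal (2⁻¹) by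
      rw [ENNReal.ofReal_inv_of_pos (by norm_num)]; simp]
    apply ENNReal.ofReal_le_ofReal
    linarith
  rw [div_eq_mul_inv]
  refine (mul_le_mul' hnum (ENNReal.inv_le_inv.2 hhalf)).trans (le_of_eq ?_)
  rw [inv_inv, mul_comm 2, ENNReal.ofReal_mul' (by norm_num)]
  simp

end Bound
end Setting

/-! ### The algorithm -/

/-- The confidence parameter of the subroutines. -/
noncomputable def confidence (T : ℕ) (δ : ℝ) : Set.Ioo (0 : ℝ) 1 :=
  ⟨(2 + 8 * (T + 1) / |δ|)⁻¹, by positivity, inv_lt_one_of_one_lt₀ (by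
    have : 0 ≤ 8 * ((T : ℝ) + 1) / |δ| := by positivity
    linarith)⟩

/-- The largest step size. -/
noncomputable def radius (L : ℝ) (T : ℕ) : ℝ := (1 + 1 / L) * T

/-- The rate of convergence is `rate τ L / n` per iteration. -/
noncomputable def rate (τ L : ℝ) : ℝ := min 1 (τ / (2 * L))

/-- The number of rounds in iteration `k`. -/
noncomputable def rounds (n : ℕ) (τ L : ℝ) (T k : ℕ) : ℕ :=
  ⌈(Real.log (4 * L * radius L T ^ 2 * n) + rate τ L * k / (2 * n)) / Real.log (16 / 9)⌉₊

/-- The coordinate-descent algorithm. -/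
noncomputable def descent (n : ℕ) (τ L : ℝ) (T : ℕ) (δ : ℝ) : CoordinateDescent :=
  fun k => lineSearch (confidence T δ) (radius L T) (rounds n τ L T k)

/-- The guaranteed decay up to iteration `k`. -/
noncomputable def decay (n : ℕ) (τ L : ℝ) (k : ℕ) : ℝ := Real.exp (-(rate τ L * k / (2 * n)))

/-- The guaranteed gap of one of the comparisons in iteration `k`. -/
noncomputable def lineGap (n : ℕ) (τ L : ℝ) (k : ℕ) : ℝ :=
  9 * τ / (512 * L) * (decay n τ L k / n)

/-- The guaranteed advantage of one of the comparisons in iteration `k`. -/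
noncomputable def advantage (κ μ δ₀ : ℝ) (n : ℕ) (τ L : ℝ) (k : ℕ) : ℝ :=
  min δ₀ (μ * lineGap n τ L k ^ (κ - 1))

/-! ### Estimates for the parameters of the algorithm -/

section Parameters
variable {n : ℕ} {τ L : ℝ} {T : ℕ} {δ : ℝ}

lemma rate_pos (hτ : 0 < τ) (hL : 0 < L) : 0 < rate τ L := lt_min one_pos (by positivity)

lemma rate_le_one : rate τ L ≤ 1 := min_le_left _ _

lemma decay_pos (k : ℕ) : 0 < decay n τ L k := Real.exp_pos _

lemma decay_anti (hτ : 0 < τ) (hL : 0 < L) {j k : ℕ} (h : j ≤ k) :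
    decay n τ L k ≤ decay n τ L j := by
  have := rate_pos hτ hL
  unfold decay
  gcongr

lemma decay_zero : decay n τ L 0 = 1 := by simp [decay]

lemma radius_pos (hL : 0 < L) (hT : 1 ≤ T) : 0 < radius L T := by
  have : (0 : ℝ) < T := by exact_mod_cast hT
  unfold radius; positivity

lemma le_radius (hL : 0 < L) : (T : ℝ) ≤ radius L T := by
  unfold radius
  have : 0 ≤ 1 / L * T := by positivity
  linarith

/-- The factor `1 + 1 / L` in `radius` serves this bound for every `L`; it keeps the logarithm in
`rounds` positive. -/
lemma one_le_mul_radius_sq (hL : 0 < L) (hT : 1 ≤ T) : 1 ≤ L * radius L T ^ 2 := by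
  have hT' : (1 : ℝ) ≤ T := by exact_mod_cast hT
  have h1 : L * (1 + 1 / L) ^ 2 = L + 2 + 1 / L := by field_simp; ring
  have h2 : 0 < 1 / L := by positivity
  have h3 : (1 : ℝ) ≤ T ^ 2 := one_le_pow₀ hT'
  unfold radius
  rw [mul_pow, ← mul_assoc, h1]
  nlinarith

lemma log_ratio_pos : 0 < Real.log (16 / 9) := Real.log_pos (by norm_num)

lemma pow_eq_exp_log (R : ℕ) : ((9 : ℝ) / 16) ^ R = Real.exp (-(R * Real.log (16 / 9))) := by
  rw [← mul_neg, ← Real.log_inv, mul_comm, Real.exp_mul, Real.exp_log (by norm_num),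
    Real.rpow_natCast]
  norm_num

variable [NeZero n]

lemma cast_pos_of_neZero : (0 : ℝ) < n := by exact_mod_cast NeZero.pos n

lemma one_le_cast_of_neZero : (1 : ℝ) ≤ n := by exact_mod_cast NeZero.one_le

lemma decay_succ (k : ℕ) :
    (1 - rate τ L / (2 * n)) * decay n τ L k ≤ decay n τ L (k + 1) := by
  have hn := cast_pos_of_neZero (n := n)
  have h : decay n τ L (k + 1) = Real.exp (-(rate τ L / (2 * n))) * decay n τ L k := by
    unfold decay
    rw [← Real.exp_add]
    congr 1
    push_cast
    field_simp
    ring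
  rw [h]
  have := Real.add_one_le_exp (-(rate τ L / (2 * n)))
  have := decay_pos (n := n) (τ := τ) (L := L) k
  gcongr
  linarith

lemma four_le_scale (hL : 0 < L) (hT : 1 ≤ T) : 4 ≤ 4 * L * radius L T ^ 2 * n := by
  have h1 := one_le_mul_radius_sq hL hT
  have h2 := one_le_cast_of_neZero (n := n)
  nlinarith

lemma rounds_arg_pos (hτ : 0 < τ) (hL : 0 < L) (hT : 1 ≤ T) (k : ℕ) :
    0 < Real.log (4 * L * radius L T ^ 2 * n) + rate τ L * k / (2 * n) := by
  have h1 := four_le_scale (n := n) hL hT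
  have h2 := Real.log_pos (show 1 < 4 * L * radius L T ^ 2 * n by linarith)
  have h3 := rate_pos hτ hL
  positivity

lemma rounds_pos (hτ : 0 < τ) (hL : 0 < L) (hT : 1 ≤ T) (k : ℕ) : 0 < rounds n τ L T k :=
  Nat.ceil_pos.2 (div_pos (rounds_arg_pos hτ hL hT k) log_ratio_pos)

lemma exp_rounds_arg (hL : 0 < L) (hT : 1 ≤ T) (k : ℕ) :
    Real.exp (-(Real.log (4 * L * radius L T ^ 2 * n) + rate τ L * k / (2 * n))) =
      decay n τ L k / (4 * L * radius L T ^ 2 * n) := by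
  have h1 := four_le_scale (n := n) hL hT
  rw [neg_add, Real.exp_add, Real.exp_neg, Real.exp_log (by linarith), decay]
  ring

lemma pow_rounds_le (hL : 0 < L) (hT : 1 ≤ T) (k : ℕ) :
    ((9 : ℝ) / 16) ^ rounds n τ L T k ≤ decay n τ L k / (4 * L * radius L T ^ 2 * n) := by
  rw [pow_eq_exp_log, ← exp_rounds_arg hL hT, Real.exp_le_exp, neg_le_neg_iff,
    ← div_le_iff₀ log_ratio_pos]
  exact Nat.le_ceil _

lemma le_pow_rounds (hτ : 0 < τ) (hL : 0 < L) (hT : 1 ≤ T) (k : ℕ) :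
    9 / 16 * (decay n τ L k / (4 * L * radius L T ^ 2 * n)) ≤
      ((9 : ℝ) / 16) ^ rounds n τ L T k := by
  have h : (9 / 16 : ℝ) = Real.exp (-Real.log (16 / 9)) := by
    rw [Real.exp_neg, Real.exp_log (by norm_num)]; norm_num
  rw [pow_eq_exp_log, ← exp_rounds_arg hL hT]
  nth_rewrite 1 [h]
  rw [← Real.exp_add, Real.exp_le_exp, ← neg_add, neg_le_neg_iff]
  have h1 := (Nat.ceil_lt_add_one
    (div_nonneg (rounds_arg_pos (n := n) hτ hL hT k).le log_ratio_pos.le)).le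
  have h2 := mul_le_mul_of_nonneg_right h1 log_ratio_pos.le
  rw [add_mul, div_mul_cancel₀ _ log_ratio_pos.ne', one_mul] at h2
  refine h2.trans (le_of_eq (add_comm _ _))

lemma rounds_slack_le (hL : 0 < L) (hT : 1 ≤ T) (k : ℕ) :
    L * (2 * radius L T * (3 / 4) ^ rounds n τ L T k) ^ 2 ≤ decay n τ L k / n := by
  have h := pow_rounds_le (n := n) (τ := τ) hL hT k
  have hB := radius_pos hL hT
  have hn := cast_pos_of_neZero (n := n)
  have h1 : L * (2 * radius L T * (3 / 4) ^ rounds n τ L T k) ^ 2 =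
      4 * L * radius L T ^ 2 * (9 / 16) ^ rounds n τ L T k := by
    rw [mul_pow, ← pow_mul, mul_comm _ 2, pow_mul]
    norm_num
    ring
  rw [h1]
  refine (mul_le_mul_of_nonneg_left h (by positivity)).trans (le_of_eq ?_)
  field_simp

/-- The ceiling in `rounds` overshoots by less than one round, that is by a factor `9 / 16`. The
constant is `1 / 8 * 9 / 16 * 1 / 4 = 9 / 512`. -/
lemma lineGap_le (hτ : 0 < τ) (hL : 0 < L) (hT : 1 ≤ T) (k : ℕ) :
    lineGap n τ L k ≤ τ / 2 * (radius L T / 2 * (3 / 4) ^ rounds n τ L T k) ^ 2 := by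
  have h := le_pow_rounds (n := n) hτ hL hT k
  have hB := radius_pos hL hT
  have hn := cast_pos_of_neZero (n := n)
  have h1 : τ / 2 * (radius L T / 2 * (3 / 4) ^ rounds n τ L T k) ^ 2 =
      τ * radius L T ^ 2 / 8 * (9 / 16) ^ rounds n τ L T k := by
    rw [mul_pow, ← pow_mul, mul_comm _ 2, pow_mul]
    norm_num
    ring
  rw [h1]
  refine le_trans (le_of_eq ?_) (mul_le_mul_of_nonneg_left h (by positivity))
  unfold lineGap
  field_simp
  ring

lemma lineGap_pos (hτ : 0 < τ) (hL : 0 < L) (k : ℕ) : 0 < lineGap n τ L k := by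
  have := decay_pos (n := n) (τ := τ) (L := L) k
  have hn := cast_pos_of_neZero (n := n)
  unfold lineGap; positivity

section Advantage
variable {κ μ δ₀ : ℝ}

lemma advantage_pos (hμ : 0 < μ) (hδ₀ : 0 < δ₀) (hτ : 0 < τ) (hL : 0 < L) (k : ℕ) :
    0 < advantage κ μ δ₀ n τ L k := by
  have := lineGap_pos (n := n) hτ hL k
  exact lt_min hδ₀ (by positivity)

lemma advantage_anti (hκ : 1 ≤ κ) (hμ : 0 < μ) (hτ : 0 < τ) (hL : 0 < L) {j k : ℕ}
    (h : j ≤ k) : advantage κ μ δ₀ n τ L k ≤ advantage κ μ δ₀ n τ L j := by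
  have h1 := decay_anti (n := n) hτ hL h
  have h2 := lineGap_pos (n := n) hτ hL k
  have h3 : lineGap n τ L k ≤ lineGap n τ L j := by unfold lineGap; gcongr
  unfold advantage
  gcongr

end Advantage

/-! ### The number of queries -/

/-- The constant in the bound for the number of queries of an iteration. -/
noncomputable def costConst (L : ℝ) : ℝ := 1536 * (12 + 3 * Real.log (4 * L * (1 + 1 / L) ^ 2))

lemma log_costConst_nonneg (hL : 0 < L) : 0 ≤ Real.log (4 * L * (1 + 1 / L) ^ 2) := by
  apply Real.log_nonneg
  have h1 : 4 * L * (1 + 1 / L) ^ 2 = 4 * (L + 2 + 1 / L) := by field_simp; ring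
  have h2 : 0 < 1 / L := by positivity
  linarith

lemma costConst_pos (hL : 0 < L) : 0 < costConst L := by
  have := log_costConst_nonneg hL
  unfold costConst; linarith

lemma rounds_le (hτ : 0 < τ) (hL : 0 < L) (hT : 1 ≤ T) (k : ℕ) :
    (rounds n τ L T k : ℝ) ≤ (12 + 3 * Real.log (4 * L * (1 + 1 / L) ^ 2)) *
      ((1 + Real.log T) * (1 + Real.log n)) * (1 + k / n) := by
  have hn := one_le_cast_of_neZero (n := n)
  have hT' : (1 : ℝ) ≤ T := by exact_mod_cast hT
  have hx := Real.log_nonneg hT'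
  have hy := Real.log_nonneg hn
  set c := Real.log (4 * L * (1 + 1 / L) ^ 2) with hc
  have hc0 : 0 ≤ c := log_costConst_nonneg hL
  have hlog : Real.log (4 * L * radius L T ^ 2 * n) = c + 2 * Real.log T + Real.log n := by
    have : 4 * L * radius L T ^ 2 * n = 4 * L * (1 + 1 / L) ^ 2 * T ^ 2 * n := by
      unfold radius; ring
    rw [this, Real.log_mul (by positivity) (by positivity),
      Real.log_mul (by positivity) (by positivity), Real.log_pow, hc]
    norm_num
  have hk : rate τ L * k / (2 * n) ≤ (k : ℝ) / n := by
    have h1 : rate τ L * k ≤ 1 * k := by gcongr; exact rate_le_one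
    rw [div_le_div_iff₀ (by positivity) (by positivity)]
    nlinarith [mul_nonneg (Nat.cast_nonneg (α := ℝ) k) (by linarith : (0 : ℝ) ≤ n)]
  have h16 : 1 / 3 ≤ Real.log (16 / 9) := by
    have := Real.one_sub_inv_le_log_of_pos (show (0 : ℝ) < 16 / 9 by norm_num)
    norm_num at this ⊢
    linarith
  have hpos := rounds_arg_pos (n := n) hτ hL hT k
  have h1 := (Nat.ceil_lt_add_one (div_nonneg hpos.le log_ratio_pos.le)).le
  have h2 : (Real.log (4 * L * radius L T ^ 2 * n) + rate τ L * k / (2 * n)) /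
      Real.log (16 / 9) ≤ 3 * (Real.log (4 * L * radius L T ^ 2 * n) +
        rate τ L * k / (2 * n)) := by
    rw [div_le_iff₀ log_ratio_pos]
    nlinarith
  refine h1.trans ((add_le_add_left h2 1).trans ?_)
  rw [hlog]
  have hkn : 0 ≤ (k : ℝ) / n := by positivity
  set x := Real.log T
  set y := Real.log n
  set z := (k : ℝ) / n
  have hxy : 1 + x + y ≤ (1 + x) * (1 + y) := by nlinarith
  have h3 : 1 + x + y + z ≤ (1 + x) * (1 + y) * (1 + z) := by nlinarith [mul_nonneg hx hy]
  have h4 : (12 + 3 * c) * (1 + x + y + z) ≤ (12 + 3 * c) * ((1 + x) * (1 + y) * (1 + z)) := by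
    gcongr
  nlinarith [mul_nonneg hc0 hx, mul_nonneg hc0 hy, mul_nonneg hc0 hkn]

omit [NeZero n] in
lemma log_two_div_confidence_le (hT : 1 ≤ T) (h0 : 0 < δ) (h1 : δ < 1) :
    Real.log (2 / confidence T δ) ≤ 4 * ((1 + Real.log T) * (1 + Real.log (1 / δ))) := by
  have hT' : (1 : ℝ) ≤ T := by exact_mod_cast hT
  have hx := Real.log_nonneg hT'
  have hz : 0 ≤ Real.log (1 / δ) := Real.log_nonneg (by rw [le_div_iff₀ h0]; linarith)
  have h36 : Real.log 36 ≤ 4 := by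
    rw [Real.log_le_iff_le_exp (by norm_num)]
    have h2 : (2.7 : ℝ) ≤ Real.exp 1 := by linarith [Real.exp_one_gt_d9]
    have h3 : Real.exp 4 = Real.exp 1 ^ 4 := by rw [← Real.exp_nat_mul]; norm_num
    rw [h3]
    calc (36 : ℝ) ≤ 2.7 ^ 4 := by norm_num
      _ ≤ _ := by gcongr
  have h4 : (2 : ℝ) / confidence T δ ≤ 36 * T * (1 / δ) := by
    simp only [confidence, abs_of_pos h0]
    rw [div_inv_eq_mul]
    have h5 : 8 * ((T : ℝ) + 1) / δ = 8 * (T + 1) * (1 / δ) := by ring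
    have h6 : 1 ≤ 1 / δ := by rw [le_div_iff₀ h0]; linarith
    rw [h5]
    nlinarith
  have hc := (confidence T δ).2.1
  refine (Real.log_le_log (by positivity) h4).trans ?_
  rw [Real.log_mul (by positivity) (by positivity), Real.log_mul (by norm_num) (by positivity)]
  nlinarith

omit [NeZero n] in
lemma confidence_le (h0 : 0 < δ) : 8 * ((T : ℝ) + 1) * (confidence T δ : ℝ) ≤ δ := by
  simp only [confidence, abs_of_pos h0]
  rw [← div_eq_mul_inv, div_le_iff₀ (by positivity), mul_add δ, mul_div_cancel₀ _ h0.ne']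
  linarith

/-- A batch number that is just large enough for iteration `k`. -/
lemma exists_batch {x : ℝ} (hx : 1 ≤ x) : ∃ l : ℕ, x ≤ 2 ^ l ∧ 2 ^ l ≤ 2 * x := by
  obtain ⟨l, h1, h2⟩ := exists_nat_pow_near hx (one_lt_two (α := ℝ))
  exact ⟨l + 1, h2.le, by rw [pow_succ]; linarith⟩

end Parameters

/-! ### From a sufficient budget to the error bound -/

section Budget
variable {n : ℕ} [NeZero n] {κ μ δ₀ τ L M : ℝ} {T : ℕ} {δ : ℝ}

omit [NeZero n] in
lemma one_le_one_add_log {T : ℕ} : 1 ≤ 1 + Real.log T := by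
  have := Real.log_natCast_nonneg T
  linarith

omit [NeZero n] in
lemma one_le_one_add_log_inv (h0 : 0 < δ) (h1 : δ < 1) : 1 ≤ 1 + Real.log (1 / δ) := by
  have : 0 ≤ Real.log (1 / δ) := Real.log_nonneg (by rw [le_div_iff₀ h0]; linarith)
  linarith

omit [NeZero n] in
lemma one_le_logFactor (h0 : 0 < δ) (h1 : δ < 1) : 1 ≤ logFactor T n δ :=
  one_le_mul_of_one_le_of_one_le
    (one_le_mul_of_one_le_of_one_le one_le_one_add_log one_le_one_add_log)
    (one_le_one_add_log_inv h0 h1)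

omit [NeZero n] in
lemma one_add_log_le_logFactor (h0 : 0 < δ) (h1 : δ < 1) : 1 + Real.log T ≤ logFactor T n δ := by
  have hx := one_le_one_add_log (T := T)
  have hy := one_le_one_add_log (T := n)
  have hz := one_le_one_add_log_inv h0 h1
  unfold logFactor
  rw [mul_assoc]
  exact le_mul_of_one_le_right (by linarith) (one_le_mul_of_one_le_of_one_le hy hz)

/-- The number of queries from which on the search interval contains all line minimizers. -/
noncomputable def largeBudget (τ L M : ℝ) : ℝ := 1 + M / L + 16 * L * M / τ ^ 2

/-- The number of draws after which a round of iteration `k` has most likely ended. -/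
noncomputable def drawBound (κ μ δ₀ τ L : ℝ) (n T : ℕ) (δ : ℝ) (k : ℕ) : ℝ :=
  48 * (1 + Real.log T) * Real.log (2 / confidence T δ) / advantage κ μ δ₀ n τ L k ^ 2

lemma one_le_drawBound (hμ : 0 < μ) (hδ₀ : 0 < δ₀) (hδ₀' : δ₀ ≤ 1 / 2) (hτ : 0 < τ) (hL : 0 < L)
    (k : ℕ) : 1 ≤ drawBound κ μ δ₀ τ L n T δ k := by
  have ha := advantage_pos (κ := κ) (n := n) hμ hδ₀ hτ hL k
  have ha' : advantage κ μ δ₀ n τ L k ≤ 1 / 2 := (min_le_left _ _).trans hδ₀'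
  have hc := (confidence T δ).2
  have h2 : 1 / 2 ≤ Real.log (2 / confidence T δ) := by
    have h3 : Real.log 2 ≤ Real.log (2 / confidence T δ) := by
      apply Real.log_le_log (by norm_num)
      rw [le_div_iff₀ hc.1]; linarith [hc.2]
    linarith [Real.log_two_gt_d9]
  have h4 := one_le_one_add_log (T := T)
  unfold drawBound
  rw [le_div_iff₀ (by positivity)]
  nlinarith

lemma cost_le (hδ : 0 < δ) (hδ' : δ < 1) (hτ : 0 < τ) (hL : 0 < L) (hT : 1 ≤ T) (k : ℕ) :
    rounds n τ L T k * (8 * drawBound κ μ δ₀ τ L n T δ k) ≤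
      costConst L * logFactor T n δ ^ 3 * (1 + k / n) / advantage κ μ δ₀ n τ L k ^ 2 := by
  have h1 := rounds_le (n := n) hτ hL hT k
  have h2 := log_two_div_confidence_le hT hδ hδ'
  have h3 := one_add_log_le_logFactor (T := T) (n := n) hδ hδ'
  have hx := one_le_one_add_log (T := T)
  have hy := one_le_one_add_log (T := n)
  have hz := one_le_one_add_log_inv hδ hδ'
  have hc := log_costConst_nonneg hL
  have hP : 0 ≤ Real.log (2 / confidence T δ) :=
    (log_two_div_pos (confidence T δ).2.1 (confidence T δ).2.2).le
  set X := 1 + Real.log T with hX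
  set Y := 1 + Real.log n with hY
  set Z := 1 + Real.log (1 / δ) with hZ
  set c := 12 + 3 * Real.log (4 * L * (1 + 1 / L) ^ 2) with hcdef
  have hΛ : logFactor T n δ = X * Y * Z := rfl
  have hc0 : 0 ≤ c := by linarith
  have h4 : 8 * drawBound κ μ δ₀ τ L n T δ k ≤
      1536 * (X * X * Z) / advantage κ μ δ₀ n τ L k ^ 2 := by
    have h9 : 8 * (48 * X * Real.log (2 / confidence T δ)) ≤ 1536 * (X * X * Z) := by
      nlinarith [mul_le_mul_of_nonneg_left h2 (by linarith : 0 ≤ X)]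
    unfold drawBound
    rw [← mul_div_assoc]
    exact div_le_div_of_nonneg_right h9 (sq_nonneg _)
  have h5 : 0 ≤ drawBound κ μ δ₀ τ L n T δ k := by
    unfold drawBound; positivity
  have h6 : 0 ≤ c * (X * Y) * (1 + (k : ℝ) / n) := by positivity
  refine (mul_le_mul h1 h4 (by linarith) h6).trans ?_
  rw [← mul_div_assoc]
  have h7 : X * X * (X * Y * Z) ≤ logFactor T n δ ^ 3 := by
    rw [pow_succ, sq, hΛ]
    rw [hΛ] at h3
    gcongr
  have h8 : c * (X * Y) * (1 + k / n) * (1536 * (X * X * Z)) =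
      costConst L * (X * X * (X * Y * Z)) * (1 + k / n) := by
    unfold costConst; ring
  rw [h8]
  have := (costConst_pos hL).le
  gcongr

/-- If `T` queries suffice for `K` iterations, then the error bound after `K` iterations holds. -/
theorem exists_event_of_budget (hκ : 1 ≤ κ) (hμ : 0 < μ) (hδ₀ : 0 < δ₀) (hδ₀' : δ₀ ≤ 1 / 2)
    (hτ : 0 < τ) (hL : 0 < L) (hM : 0 ≤ M) (hT : 1 ≤ T) (hδ : 0 < δ) (hδ' : δ < 1)
    {f : E n → ℝ} (hf : StronglyConvexSmooth τ L f) {C : Oracle n}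
    (hC : IsComparisonOracle κ μ δ₀ f C) {x₀ xstar : E n} (hmin : ∀ y, f xstar ≤ f y)
    (hx : f x₀ - f xstar ≤ M) {K : ℕ} (hlarge : 0 < K → largeBudget τ L M ≤ T)
    (hK : K * (costConst L * logFactor T n δ ^ 3 * (1 + K / n)) ≤
      T * advantage κ μ δ₀ n τ L K ^ 2) :
    ∃ A : Set (Run n),
      ENNReal.ofReal (1 - δ) ≤ (runLaw (descent n τ L T δ) C x₀ T).toOuterMeasure A ∧
      condMean (runLaw (descent n τ L T δ) C x₀ T) A
          (fun r => ENNReal.ofReal (f r.estimate - f xstar)) ≤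
        ENNReal.ofReal (2 * ((M + 2 / rate τ L) * decay n τ L K)) := by
  have hn := cast_pos_of_neZero (n := n)
  have hn1 := one_le_cast_of_neZero (n := n)
  have hT' : (1 : ℝ) ≤ T := by exact_mod_cast hT
  have hρ := rate_pos hτ hL
  have hB := radius_pos hL hT
  choose l hl hl' using fun k => exists_batch
    (one_le_drawBound (κ := κ) (n := n) (T := T) (δ := δ) hμ hδ₀ hδ₀' hτ hL k)
  have hadv : ∀ k, 0 < advantage κ μ δ₀ n τ L k := advantage_pos hμ hδ₀ hτ hL
  have hcost : ∀ k < K, ((rounds n τ L T k * 2 ^ (l k + 2) : ℕ) : ℝ) ≤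
      costConst L * logFactor T n δ ^ 3 * (1 + K / n) / advantage κ μ δ₀ n τ L K ^ 2 := by
    intro k hk
    have h1 := cost_le (n := n) (κ := κ) (μ := μ) (δ₀ := δ₀) hδ hδ' hτ hL hT k
    have h2 := hl' k
    have h3 : ((rounds n τ L T k * 2 ^ (l k + 2) : ℕ) : ℝ) ≤
        rounds n τ L T k * (8 * drawBound κ μ δ₀ τ L n T δ k) := by
      have h4 : (2 : ℝ) ^ (l k + 2) ≤ 8 * drawBound κ μ δ₀ τ L n T δ k := by
        rw [pow_add]; linarith
      push_cast
      exact mul_le_mul_of_nonneg_left h4 (Nat.cast_nonneg _)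
    refine h3.trans (h1.trans ?_)
    have h4 := (costConst_pos hL).le
    have h5 := one_le_logFactor (T := T) (n := n) hδ hδ'
    have h6 := hadv K
    have h7 := advantage_anti (n := n) (κ := κ) (δ₀ := δ₀) hκ hμ hτ hL hk.le
    gcongr
  have hsum : ∑ k ∈ Finset.range K, rounds n τ L T k * 2 ^ (l k + 2) ≤ T := by
    have h1 : ((∑ k ∈ Finset.range K, rounds n τ L T k * 2 ^ (l k + 2) : ℕ) : ℝ) ≤ T := by
      rw [Nat.cast_sum]
      refine (Finset.sum_le_sum fun k hk => hcost k (Finset.mem_range.1 hk)).trans ?_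
      rw [Finset.sum_const, Finset.card_range, nsmul_eq_mul, ← mul_div_assoc,
        div_le_iff₀ (pow_pos (hadv K) 2)]
      exact hK
    exact_mod_cast h1
  -- The factor `l + 1` of the stopping rule was replaced by `3 (1 + log T)` when the batch was
  -- chosen. The resulting costs sum to at most `T`, so `2 ^ l ≤ T`, which justifies the
  -- replacement.
  have hlT : ∀ k < K, (l k : ℝ) + 1 ≤ 3 * (1 + Real.log T) := by
    intro k hk
    have h1 : 2 ^ l k ≤ T := by
      refine le_trans ?_ ((Finset.single_le_sum (f := fun k => rounds n τ L T k * 2 ^ (l k + 2))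
        (fun _ _ => Nat.zero_le _) (Finset.mem_range.2 hk)).trans hsum)
      have h2 := rounds_pos (n := n) hτ hL hT k
      calc 2 ^ l k ≤ 2 ^ (l k + 2) := Nat.pow_le_pow_right (by norm_num) (by omega)
        _ ≤ _ := Nat.le_mul_of_pos_left _ h2
    have h3 : (l k : ℝ) * Real.log 2 ≤ Real.log T := by
      rw [← Real.log_pow]
      apply Real.log_le_log (by positivity)
      exact_mod_cast h1
    nlinarith [Real.log_two_gt_d9, Nat.cast_nonneg (α := ℝ) (l k)]
  let S : Setting n τ L f C :=
    { m := f xstar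
      M := M
      B := radius L T
      c := confidence T δ
      R := rounds n τ L T
      K := K
      batch := l
      adv := advantage κ μ δ₀ n τ L
      gap := lineGap n τ L
      τ_pos := hτ
      L_pos := hL
      convex := hf
      le_f := hmin
      exists_eq := ⟨xstar, rfl⟩
      B_pos := hB
      R_pos := rounds_pos hτ hL hT
      half_le := by
        intro x y hxy
        refine le_trans ?_ (hC x y hxy)
        have : 0 ≤ min δ₀ (μ * |f y - f x| ^ (κ - 1)) := le_min hδ₀.le (by positivity)
        linarith
      adv_pos := fun k _ => hadv k
      adv_le := fun k _ => (min_le_left _ _).trans hδ₀'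
      le_answer := by
        intro k _ x y hxy
        have hg := lineGap_pos (n := n) hτ hL k
        have hlt : f x < f y := by linarith
        have h1 := hC x y hlt.ne
        rw [decide_eq_true hlt] at h1
        refine le_trans ?_ h1
        have h2 : lineGap n τ L k ≤ |f y - f x| := by
          rw [abs_of_pos (by linarith)]; linarith
        unfold advantage
        gcongr
      gap_le := fun k _ => lineGap_le hτ hL hT k
      le_batch := by
        intro k hk
        have h1 := hl k
        unfold drawBound at h1
        rw [div_le_iff₀ (pow_pos (hadv k) 2)] at h1
        have h2 := hlT k hk
        have h3 := log_two_div_pos (confidence T δ).2.1 (confidence T δ).2.2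
        have h4 := mul_le_mul_of_nonneg_right h2 h3.le
        linarith
      M_le := by
        intro h
        have h1 := hlarge h
        unfold largeBudget at h1
        have h2 := le_radius (T := T) hL
        have h3 : 0 ≤ 16 * L * M / τ ^ 2 := by positivity
        have h4 : M / L ≤ radius L T ^ 2 := by nlinarith
        rw [div_le_iff₀ hL] at h4
        linarith
      M_lt := by
        intro h
        have h1 := hlarge h
        unfold largeBudget at h1
        have h2 := le_radius (T := T) hL
        have h3 : 0 ≤ M / L := by positivity
        have h4 : 16 * L * M / τ ^ 2 < radius L T ^ 2 := by nlinarith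
        rw [div_lt_iff₀ (by positivity)] at h4
        linarith }
  have hbound : S.IsBound (rate τ L) (fun k => (M + 2 / rate τ L) * decay n τ L k) :=
    { pos := hρ
      le_one := rate_le_one
      le_div := min_le_right _ _
      nonneg := by rw [decay_zero]; positivity
      M_le := by
        rw [decay_zero, mul_one]
        have : 0 < 2 / rate τ L := by positivity
        change M ≤ _
        linarith
      rec_le := by
        intro k _
        have h1 : S.slack k ≤ decay n τ L k / n := rounds_slack_le hL hT k
        have h2 := decay_succ (n := n) (τ := τ) (L := L) k
        have hq := decay_pos (n := n) (τ := τ) (L := L) k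
        have hE : 0 ≤ M + 2 / rate τ L := by positivity
        have h3 := mul_le_mul_of_nonneg_left h2 hE
        -- The slack must fit between the contractions `1 - ρ / n` and `1 - ρ / (2 n)`. The summand
        -- `2 / ρ` of the constant is chosen so that `2 / ρ * (ρ / (2 n)) = 1 / n`.
        have h4 : decay n τ L k / n ≤
            (M + 2 / rate τ L) * (rate τ L / (2 * n)) * decay n τ L k := by
          have h5 : 1 / (n : ℝ) = 2 / rate τ L * (rate τ L / (2 * n)) := by field_simp
          have h6 : 0 ≤ M * (rate τ L / (2 * n)) := by positivity
          rw [div_eq_mul_one_div, mul_comm]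
          gcongr
          rw [h5]
          linarith
        have h7 : rate τ L / n = 2 * (rate τ L / (2 * n)) := by field_simp
        rw [h7]
        linarith }
  exact hbound.exists_event hsum hx hδ hδ' (confidence_le hδ)

end Budget

/-! ### The number of iterations that the budget allows -/

section Rates
variable {n : ℕ} [NeZero n] {κ μ δ₀ τ L M : ℝ} {T : ℕ} {δ : ℝ}

lemma largeBudget_pos (hτ : 0 < τ) (hL : 0 < L) (hM : 0 ≤ M) : 0 < largeBudget τ L M := by
  unfold largeBudget; positivity

/-- Rounding loses at most one iteration, a factor of at most `e ≤ 3`. -/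
lemma decay_floor_le (hτ : 0 < τ) (hL : 0 < L) (x : ℝ) :
    decay n τ L ⌊x⌋₊ ≤ 3 * Real.exp (-(rate τ L * x / (2 * n))) := by
  have hn := one_le_cast_of_neZero (n := n)
  have hρ := rate_pos hτ hL
  have hx := (Nat.lt_floor_add_one x).le
  have h1 : rate τ L * x / (2 * n) ≤ rate τ L * ⌊x⌋₊ / (2 * n) + 1 := by
    have h2 : rate τ L * x ≤ rate τ L * (⌊x⌋₊ + 1) := by gcongr
    have h3 : rate τ L ≤ 1 := rate_le_one
    rw [div_add_one (by positivity)]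
    gcongr
    linarith
  have h3 : Real.exp 1 ≤ 3 := by linarith [Real.exp_one_lt_d9]
  refine le_trans ?_ (mul_le_mul_of_nonneg_right h3 (Real.exp_pos _).le)
  rw [← Real.exp_add]
  apply Real.exp_le_exp.2
  linarith

/-- The number of iterations for noise that does not depend on the gap. -/
lemma exists_iterations_linear (hμ : 0 < μ) (hδ₀ : 0 < δ₀) (hτ : 0 < τ) (hL : 0 < L)
    (hM : 0 ≤ M) : ∃ c₁ c₂ : ℝ, 0 < c₁ ∧ 0 < c₂ ∧
    ∀ (n : ℕ) [NeZero n] (T : ℕ) (δ : ℝ), 1 ≤ T → 0 < δ → δ < 1 →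
    ∃ K : ℕ, (0 < K → largeBudget τ L M ≤ T) ∧
      K * (costConst L * logFactor T n δ ^ 3 * (1 + K / n)) ≤
        T * advantage 1 μ δ₀ n τ L K ^ 2 ∧
      decay n τ L K ≤ c₁ * Real.exp (-(c₂ / logFactor T n δ ^ 3) * √((T : ℝ) / n)) := by
  have hC := costConst_pos hL
  have hρ := rate_pos hτ hL
  set e := min δ₀ μ with he
  have he0 : 0 < e := lt_min hδ₀ hμ
  set g := e ^ 2 / (2 * costConst L) ⊓ 1 with hg
  have hg0 : 0 < g := lt_min (by positivity) one_pos
  have hT0 := largeBudget_pos hτ hL hM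
  set T0 := largeBudget τ L M with hT0def
  refine ⟨3 * Real.exp (rate τ L * g / 2 * (√T0 + 1)), rate τ L * g / 2, by positivity,
    by positivity, ?_⟩
  intro n _ T δ hT hδ hδ'
  have hn := cast_pos_of_neZero (n := n)
  have hn1 := one_le_cast_of_neZero (n := n)
  have hT' : (0 : ℝ) < T := by exact_mod_cast hT
  have hΛ := one_le_logFactor (T := T) (n := n) hδ hδ'
  have hadv : ∀ k, advantage 1 μ δ₀ n τ L k = e := by
    intro k; simp [advantage, he]
  set Λ := logFactor T n δ ^ 3 with hΛdef
  have hΛ1 : 1 ≤ Λ := one_le_pow₀ hΛ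
  set s := √((T : ℝ) / n) with hs
  have hs2 : s ^ 2 = T / n := Real.sq_sqrt (by positivity)
  have hs0 : 0 ≤ s := Real.sqrt_nonneg _
  have hd : rate τ L * g / 2 / Λ ≤ rate τ L * g / 2 := div_le_self (by positivity) hΛ1
  by_cases hbig : T0 ≤ T ∧ 1 ≤ s
  -- With `K Λ ≤ n s g` and `1 + K / n ≤ 2 s` the cost is at most `n s ^ 2 = T` times `2 g *
  -- costConst L ≤ e ^ 2`. The cap `g ≤ 1` gives `K / n ≤ s`.
  · refine ⟨⌊n * s * g / Λ⌋₊, fun _ => hbig.1, ?_, ?_⟩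
    · rw [hadv]
      have hK : (⌊n * s * g / Λ⌋₊ : ℝ) ≤ n * s * g / Λ := Nat.floor_le (by positivity)
      set K : ℝ := (⌊n * s * g / Λ⌋₊ : ℝ)
      have hK0 : 0 ≤ K := Nat.cast_nonneg _
      have hKs : K / n ≤ s := by
        rw [div_le_iff₀ hn]
        refine hK.trans ((div_le_self (by positivity) hΛ1).trans ?_)
        have : n * s * g ≤ n * s * 1 := by gcongr; exact inf_le_right
        linarith
      rw [le_div_iff₀ (by positivity)] at hK
      have hgC : g * (2 * costConst L) ≤ e ^ 2 := by
        rw [← le_div_iff₀ (by positivity)]; exact inf_le_left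
      have hT2 : (T : ℝ) = n * s ^ 2 := by rw [hs2]; field_simp
      calc K * (costConst L * Λ * (1 + K / n)) = (K * Λ) * (costConst L * (1 + K / n)) := by ring
        _ ≤ (n * s * g) * (costConst L * (s + s)) := by
          gcongr
          exact hbig.2
        _ = (n * s ^ 2) * (g * (2 * costConst L)) := by ring
        _ ≤ T * e ^ 2 := by rw [← hT2]; gcongr
    · refine (decay_floor_le hτ hL _).trans ?_
      have h1 : -(rate τ L * (n * s * g / Λ) / (2 * n)) = -(rate τ L * g / 2 / Λ) * s := by
        field_simp
      rw [h1]
      have h2 : 1 ≤ Real.exp (rate τ L * g / 2 * (√T0 + 1)) := Real.one_le_exp (by positivity)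
      gcongr
      linarith
  -- Here `s ≤ √T0 + 1`, and the exponential in `c₁` makes the claimed bound at least `1`; no
  -- iteration is needed.
  · refine ⟨0, by simp, by simp; positivity, ?_⟩
    rw [decay_zero]
    have hs1 : s ≤ √T0 + 1 := by
      by_cases h1 : 1 ≤ s
      · have h2 : (T : ℝ) < T0 := by
          by_contra! h3
          exact hbig ⟨h3, h1⟩
        have h4 : s ≤ √T0 := by
          apply Real.sqrt_le_sqrt
          exact (div_le_self hT'.le hn1).trans h2.le
        linarith
      · have := Real.sqrt_nonneg T0
        linarith
    rw [mul_assoc, ← Real.exp_add]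
    have h1 : rate τ L * g / 2 / Λ * s ≤ rate τ L * g / 2 * (√T0 + 1) := by gcongr
    have h2 := Real.one_le_exp (show 0 ≤ rate τ L * g / 2 * (√T0 + 1) +
      -(rate τ L * g / 2 / Λ) * s by linarith)
    linarith

lemma le_advantage (hκ : 1 ≤ κ) (hδ₀ : 0 < δ₀) (hτ : 0 < τ) (hL : 0 < L) (k : ℕ) :
    min δ₀ (μ * (9 * τ / (512 * L)) ^ (κ - 1)) * (decay n τ L k / n) ^ (κ - 1) ≤
      advantage κ μ δ₀ n τ L k := by
  have hn := one_le_cast_of_neZero (n := n)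
  have hq := decay_pos (n := n) (τ := τ) (L := L) k
  have hq1 : decay n τ L k ≤ 1 := by
    rw [← decay_zero (n := n) (τ := τ) (L := L)]
    exact decay_anti hτ hL (Nat.zero_le k)
  have h1 : decay n τ L k / n ≤ 1 := by
    rw [div_le_one (by linarith)]; linarith
  have h2 : (decay n τ L k / n) ^ (κ - 1) ≤ 1 :=
    Real.rpow_le_one (by positivity) h1 (by linarith)
  have h3 : 0 ≤ (decay n τ L k / n) ^ (κ - 1) := by positivity
  apply le_min
  · have h4 : min δ₀ (μ * (9 * τ / (512 * L)) ^ (κ - 1)) ≤ δ₀ := min_le_left _ _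
    nlinarith
  · have h4 : min δ₀ (μ * (9 * τ / (512 * L)) ^ (κ - 1)) ≤ μ * (9 * τ / (512 * L)) ^ (κ - 1) :=
      min_le_right _ _
    unfold lineGap
    rw [Real.mul_rpow (by positivity) (by positivity), ← mul_assoc]
    gcongr

/-- The number of iterations for noise that grows as the gap gets small. -/
lemma exists_iterations_sublinear (hκ : 1 < κ) (hμ : 0 < μ) (hδ₀ : 0 < δ₀) (hτ : 0 < τ)
    (hL : 0 < L) (hM : 0 ≤ M) : ∃ c₃ : ℝ, 0 < c₃ ∧
    ∀ (n : ℕ) [NeZero n] (T : ℕ) (δ : ℝ), 1 ≤ T → 0 < δ → δ < 1 →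
    ∃ K : ℕ, (0 < K → largeBudget τ L M ≤ T) ∧
      K * (costConst L * logFactor T n δ ^ 3 * (1 + K / n)) ≤
        T * advantage κ μ δ₀ n τ L K ^ 2 ∧
      decay n τ L K ≤ c₃ * logFactor T n δ ^ ⌈5 / (2 * (κ - 1))⌉₊ * n *
        ((n : ℝ) / T) ^ (1 / (2 * (κ - 1))) := by
  have hC := costConst_pos hL
  have hρ := rate_pos hτ hL
  have hT0 := largeBudget_pos hτ hL hM
  set T0 := largeBudget τ L M with hT0def
  set β := 2 * (κ - 1) with hβ
  have hβ0 : 0 < β := by rw [hβ]; linarith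
  -- Five logarithmic factors must be absorbed by `(Λ ^ a) ^ β`: three from the cost of an
  -- iteration, one from `K` and one from `1 + K / n`.
  set a := ⌈5 / β⌉₊ with ha
  have haβ : 5 ≤ a * β := by
    rw [← div_le_iff₀ hβ0]; exact Nat.le_ceil _
  set e := min δ₀ (μ * (9 * τ / (512 * L)) ^ (κ - 1)) with he
  have he0 : 0 < e := lt_min hδ₀ (by positivity)
  set D := 2 / (rate τ L * β) with hD
  have hD0 : 0 < D := by positivity
  set F := D * costConst L * (1 + D) / e ^ 2 with hF
  have hF0 : 0 < F := by positivity
  set c := max 1 (F ^ (1 / β)) with hc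
  have hc1 : 1 ≤ c := le_max_left _ _
  have hcF : F ≤ c ^ β := by
    calc F = (F ^ (1 / β)) ^ β := by
          rw [← Real.rpow_mul hF0.le, one_div_mul_cancel hβ0.ne', Real.rpow_one]
      _ ≤ c ^ β := by gcongr; exact le_max_right _ _
  refine ⟨3 * c + T0 ^ (1 / β), by positivity, ?_⟩
  intro n _ T δ hT hδ hδ'
  have hn := cast_pos_of_neZero (n := n)
  have hn1 := one_le_cast_of_neZero (n := n)
  have hT1 : (1 : ℝ) ≤ T := by exact_mod_cast hT
  have hT' : (0 : ℝ) < T := by linarith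
  have hΛ := one_le_logFactor (T := T) (n := n) hδ hδ'
  have hΛX := one_add_log_le_logFactor (T := T) (n := n) hδ hδ'
  set Λ := logFactor T n δ with hΛdef
  have hΛ0 : 0 < Λ := by linarith
  set v := (n : ℝ) * ((n : ℝ) / T) ^ (1 / β) with hv
  have hv0 : 0 < v := by positivity
  set u := c * Λ ^ a * v with hu
  have hu0 : 0 < u := by positivity
  have hT0' : 0 < T0 ^ (1 / β) := by positivity
  have hgoal : (3 * c + T0 ^ (1 / β)) * Λ ^ a * n * ((n : ℝ) / T) ^ (1 / β) =
      3 * u + T0 ^ (1 / β) * Λ ^ a * v := by rw [hu, hv]; ring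
  rw [hgoal]
  by_cases hbig : T0 ≤ T ∧ u < 1
  -- The decay reaches the target `u` at the real time `x`. Rounding down keeps the decay above `u`,
  -- and with it the advantage that the budget needs.
  · set x := Real.log (1 / u) * (2 * n / rate τ L) with hx
    have hlog0 : 0 ≤ Real.log (1 / u) :=
      Real.log_nonneg (by rw [le_div_iff₀ hu0]; linarith [hbig.2])
    have hux : Real.exp (-(rate τ L * x / (2 * n))) = u := by
      have : rate τ L * x / (2 * n) = Real.log (1 / u) := by rw [hx]; field_simp
      rw [this, one_div, Real.log_inv, neg_neg, Real.exp_log hu0]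
    refine ⟨⌊x⌋₊, fun _ => hbig.1, ?_, ?_⟩
    · have hxK : (⌊x⌋₊ : ℝ) ≤ x := Nat.floor_le (by positivity)
      have hq : u ≤ decay n τ L ⌊x⌋₊ := by
        rw [← hux]
        unfold decay
        gcongr
      have hadv := le_advantage (n := n) (μ := μ) hκ.le hδ₀ hτ hL ⌊x⌋₊
      rw [← he] at hadv
      set K : ℝ := (⌊x⌋₊ : ℝ)
      have hK0 : 0 ≤ K := Nat.cast_nonneg _
      -- The target is at worst polynomially small in `T`, so `K / n` is logarithmic.
      have huT : 1 / u ≤ (T : ℝ) ^ (1 / β) := by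
        have h1 : ((T : ℝ) ^ (1 / β))⁻¹ ≤ u := by
          have h2 : (T : ℝ)⁻¹ ^ (1 / β) ≤ ((n : ℝ) / T) ^ (1 / β) := by
            gcongr
            rw [inv_eq_one_div]
            gcongr
          rw [Real.inv_rpow hT'.le] at h2
          have h3 : 1 ≤ c * Λ ^ a * n :=
            one_le_mul_of_one_le_of_one_le
              (one_le_mul_of_one_le_of_one_le hc1 (one_le_pow₀ hΛ)) hn1
          have h4 : 0 ≤ ((n : ℝ) / T) ^ (1 / β) := by positivity
          calc ((T : ℝ) ^ (1 / β))⁻¹ ≤ 1 * ((n : ℝ) / T) ^ (1 / β) := by rw [one_mul]; exact h2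
            _ ≤ c * Λ ^ a * n * ((n : ℝ) / T) ^ (1 / β) := by gcongr
            _ = u := by rw [hu, hv]; ring
        rw [one_div]
        exact inv_le_of_inv_le₀ (by positivity) h1
      have hlog : Real.log (1 / u) ≤ 1 / β * Λ := by
        refine (Real.log_le_log (by positivity) huT).trans ?_
        rw [Real.log_rpow hT']
        gcongr
        linarith
      have hKn : K ≤ n * (D * Λ) := by
        refine hxK.trans ?_
        have h1 : n * (D * Λ) = 1 / β * Λ * (2 * n / rate τ L) := by rw [hD]; field_simp
        rw [h1, hx]
        gcongr
      have hKn' : K / n ≤ D * Λ := by rw [div_le_iff₀ hn]; linarith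
      have hmain : F * Λ ^ 5 ≤ c ^ β * (Λ ^ a) ^ β := by
        have h1 : Λ ^ 5 ≤ (Λ ^ a) ^ β := by
          rw [← Real.rpow_natCast, ← Real.rpow_natCast, ← Real.rpow_mul hΛ0.le]
          exact Real.rpow_le_rpow_of_exponent_le hΛ (by push_cast; exact haβ)
        gcongr
      have huβ : (u / n) ^ β = c ^ β * (Λ ^ a) ^ β * (n / T) := by
        have h1 : u / n = c * Λ ^ a * ((n : ℝ) / T) ^ (1 / β) := by
          rw [hu, hv]; field_simp
        rw [h1, Real.mul_rpow (by positivity) (by positivity),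
          Real.mul_rpow (by positivity) (by positivity), ← Real.rpow_mul (by positivity),
          one_div_mul_cancel hβ0.ne', Real.rpow_one]
      have hadv2 : e ^ 2 * (u / n) ^ β ≤ advantage κ μ δ₀ n τ L ⌊x⌋₊ ^ 2 := by
        have h1 : (u / n) ^ β = ((u / n) ^ (κ - 1)) ^ 2 := by
          rw [← Real.rpow_natCast, ← Real.rpow_mul (by positivity), hβ]
          congr 1; push_cast; ring
        rw [h1, ← mul_pow]
        apply pow_le_pow_left₀ (by positivity)
        refine le_trans ?_ hadv
        have : 0 ≤ κ - 1 := by linarith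
        gcongr
      calc K * (costConst L * Λ ^ 3 * (1 + K / n))
          ≤ n * (D * Λ) * (costConst L * Λ ^ 3 * (Λ + D * Λ)) := by gcongr
        _ = n * (e ^ 2 * (F * Λ ^ 5)) := by rw [hF]; field_simp
        _ ≤ n * (e ^ 2 * (c ^ β * (Λ ^ a) ^ β)) := by gcongr
        _ = T * (e ^ 2 * (u / n) ^ β) := by rw [huβ]; field_simp
        _ ≤ _ := by gcongr
    · refine (decay_floor_le hτ hL _).trans ?_
      rw [hux]
      have : 0 < T0 ^ (1 / β) * Λ ^ a * v := by positivity
      linarith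
  -- Either the target `u` is at least `1`, or `T < T0` and the summand with `T0 ^ (1 / β)` is at
  -- least `1`; both make `K = 0` sufficient.
  · refine ⟨0, by simp, by simp; positivity, ?_⟩
    rw [decay_zero]
    by_cases h1 : u < 1
    · have h2 : (T : ℝ) < T0 := by
        by_contra! h3
        exact hbig ⟨h3, h1⟩
      have h3 : 1 ≤ T0 ^ (1 / β) * ((n : ℝ) / T) ^ (1 / β) := by
        rw [← Real.mul_rpow hT0.le (by positivity)]
        apply Real.one_le_rpow _ (by positivity)
        rw [← mul_div_assoc, le_div_iff₀ hT']
        nlinarith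
      have h4 : 1 ≤ Λ ^ a * n * (T0 ^ (1 / β) * ((n : ℝ) / T) ^ (1 / β)) :=
        one_le_mul_of_one_le_of_one_le
          (one_le_mul_of_one_le_of_one_le (one_le_pow₀ hΛ) hn1) h3
      have h5 : T0 ^ (1 / β) * Λ ^ a * v =
          Λ ^ a * n * (T0 ^ (1 / β) * ((n : ℝ) / T) ^ (1 / β)) := by rw [hv]; ring
      rw [h5]
      linarith
    · have : 0 < T0 ^ (1 / β) * Λ ^ a * v := by positivity
      linarith

end Rates
end PairwiseDescent

/-- One family of coordinate-descent algorithms, which knows `n`, `τ`, `L`, the budget `T` and the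
confidence `δ`, but neither the oracle parameters `κ`, `μ`, `δ₀`, nor the initial error bound `M`. -/
theorem theorem2 :
    ∃ alg : (n : ℕ) → (τ L : ℝ) → (T : ℕ) → (δ : ℝ) → CoordinateDescent,
      ∀ κ : ℝ, 1 ≤ κ →
      ∃ a : ℕ, ∀ μ δ₀ τ L M : ℝ, 0 < μ → 0 < δ₀ → δ₀ ≤ 1 / 2 → 0 < τ → 0 < L →
      ∃ c₁ c₂ c₃ : ℝ, 0 < c₁ ∧ 0 < c₂ ∧ 0 < c₃ ∧
      ∀ (n : ℕ) [NeZero n] (T : ℕ) (δ : ℝ), 1 ≤ T → 0 < δ → δ < 1 →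
      ∀ (f : E n → ℝ), StronglyConvexSmooth τ L f →
      ∀ (C : Oracle n), IsComparisonOracle κ μ δ₀ f C →
      ∀ (x₀ xstar : E n), (∀ y, f xstar ≤ f y) → f x₀ - f xstar ≤ M →
      ∃ A : Set (Run n),
        ENNReal.ofReal (1 - δ) ≤ (runLaw (alg n τ L T δ) C x₀ T).toOuterMeasure A ∧
        condMean (runLaw (alg n τ L T δ) C x₀ T) A
            (fun r => ENNReal.ofReal (f r.estimate - f xstar)) ≤
          ENNReal.ofReal (errorBound κ (c₁ * logFactor T n δ ^ a) (c₂ / logFactor T n δ ^ a)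
            (c₃ * logFactor T n δ ^ a) n T) := by
  refine ⟨descent, fun κ hκ => ?_⟩
  rcases hκ.eq_or_lt with rfl | hκ'
  · refine ⟨3, fun μ δ₀ τ L M hμ hδ₀ hδ₀' hτ hL => ?_⟩
    -- `M` may be negative, whereas the analysis uses a nonnegative bound for the initial error.
    have hM := le_max_right M 0
    have hρ := rate_pos hτ hL
    obtain ⟨c₁, c₂, hc₁, hc₂, H⟩ := exists_iterations_linear hμ hδ₀ hτ hL hM
    refine ⟨2 * (max M 0 + 2 / rate τ L) * c₁, c₂, 1, by positivity, hc₂, one_pos, ?_⟩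
    intro n _ T δ hT hδ hδ' f hf C hC x₀ xstar hmin hx
    obtain ⟨K, hlarge, hK, hd⟩ := H n T δ hT hδ hδ'
    obtain ⟨A, hA, hmean⟩ := exists_event_of_budget hκ hμ hδ₀ hδ₀' hτ hL hM hT hδ hδ' hf hC hmin
      (hx.trans (le_max_left _ _)) hlarge hK
    refine ⟨A, hA, hmean.trans (ENNReal.ofReal_le_ofReal ?_)⟩
    have hΛ : 1 ≤ logFactor T n δ ^ 3 := one_le_pow₀ (one_le_logFactor hδ hδ')
    rw [errorBound, if_pos rfl]
    calc 2 * ((max M 0 + 2 / rate τ L) * decay n τ L K)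
        ≤ 2 * ((max M 0 + 2 / rate τ L) *
          (c₁ * Real.exp (-(c₂ / logFactor T n δ ^ 3) * √((T : ℝ) / n)))) := by gcongr
      _ = 2 * (max M 0 + 2 / rate τ L) * c₁ * 1 *
          Real.exp (-(c₂ / logFactor T n δ ^ 3) * √((T : ℝ) / n)) := by ring
      _ ≤ _ := by gcongr
  · refine ⟨⌈5 / (2 * (κ - 1))⌉₊, fun μ δ₀ τ L M hμ hδ₀ hδ₀' hτ hL => ?_⟩
    have hM := le_max_right M 0
    have hρ := rate_pos hτ hL
    obtain ⟨c₃, hc₃, H⟩ := exists_iterations_sublinear hκ' hμ hδ₀ hτ hL hM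
    refine ⟨1, 1, 2 * (max M 0 + 2 / rate τ L) * c₃, one_pos, one_pos, by positivity, ?_⟩
    intro n _ T δ hT hδ hδ' f hf C hC x₀ xstar hmin hx
    obtain ⟨K, hlarge, hK, hd⟩ := H n T δ hT hδ hδ'
    obtain ⟨A, hA, hmean⟩ := exists_event_of_budget hκ hμ hδ₀ hδ₀' hτ hL hM hT hδ hδ' hf hC hmin
      (hx.trans (le_max_left _ _)) hlarge hK
    refine ⟨A, hA, hmean.trans (ENNReal.ofReal_le_ofReal ?_)⟩
    rw [errorBound, if_neg hκ'.ne']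
    refine (mul_le_mul_of_nonneg_left (mul_le_mul_of_nonneg_left hd (by positivity))
      zero_le_two).trans (le_of_eq (by ring))
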